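/- Let $\mathbf X$ be a non-empty Polish space with its Borel $\sigma$-algebra and let $V:\mathbf X\to[0,\infty)$ be measurable. For finite measures $\mu,\nu$ on $\mathbf X$ and measurable $W:\mathbf X\to[0,\infty)$, $\beta\ge 0$, put $$d_{\beta}^{W}(\mu,\nu)=\int_{\mathbf X}(1+\beta W(x))\,|\mu-\nu|(dx)\in[0,\infty],$$ so that $d_0:=d_0^{V}$ is the total variation metric (with maximal value $2$ on probability measures). Let $\mathcal P$ be a Markov kernel on $\mathbf X$ such that (A1) $(\mathcal P V)(x)\le\gamma V(x)+K$ for all $x$, for some $\gamma\in(0,1)$, $K>0$; (A2) for every $R>0$ there is $\bar\alpha_0\in(0,1)$ with $d_0(\delta_x\mathcal P,\delta_y\mathcal P)\le 2\bar\alpha_0$ whenever $V(x)\le R$ and $V(y)\le R$. For a constant $C$, let $\mathrm{MSE}(C)$ be the following statement. For all $\delta\ge 0$, $\gamma_\epsilon\in(0,1)$, $K_\epsilon>0$ there are real numbers $c_0,c_1$ with $$c_0\le 2+5\,\frac{(\delta\vee\sqrt\delta)(K_\epsilon\vee\sqrt{K_\epsilon})}{(1-\sqrt{\gamma_\epsilon})^2},\qquad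 c_1=2+\frac{\sqrt{K_\epsilon}}{1-\sqrt{\gamma_\epsilon}},$$ such that for every $\epsilon\ge 0$ and every Markov kernel $\mathcal P_\epsilon$ on $\mathbf X$ satisfying, for all $x$, (A3) $d_1^{V}(\delta_x\mathcal P,\delta_x\mathcal P_\epsilon)\le\epsilon(1+\delta V(x))$ and (A4) $(\mathcal P_\epsilon V)(x)\le\gamma_\epsilon V(x)+K_\epsilon$, for every $x_0\in\mathbf X$, every Markov chain $(X_k^\epsilon)_{k\ge0}$ with transition kernel $\mathcal P_\epsilon$ and $X_0^\epsilon=x_0$, every measurable $\varphi$ with $|\varphi|\le\sqrt V$, and every $n\ge1$, the following expectation is finite and $$\mathbf E\Big(\frac1n\sum_{k=0}^{n-1}\varphi(X_k^\epsilon)-\mu_0\varphi\Big)^2\le 3C^2\epsilon c_0+\frac{3C^2}{n}\Big(2+\frac{2K_\epsilon}{1-\gamma_\epsilon}+\frac{\epsilon\delta c_1V(x_0)}{1-\sqrt{\gamma_\epsilon}}\Big)+\mathcal O\Big(\frac1{n^2}\Big),$$ where, for given $\mathcal P,V,\mu_0,C$, the implied constant depends only on $\gamma_\epsilon,K_\epsilon,V(x_0)$.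 Then $\mathcal P$ has a unique invariant probability measure $\mu_0$, it satisfies $\mu_0V<\infty$, and the following hold. (i) There are $\beta>0$, $\bar\alpha\in(0,1)$ with $d_\beta^{V}(\nu_1\mathcal P,\nu_2\mathcal P)\le\bar\alpha\,d_\beta^{V}(\nu_1,\nu_2)$ for all probability measures $\nu_1,\nu_2$, and there are $\beta_{(1/2)}>\beta$, $\bar\alpha_{(1/2)}\in(0,1)$ with $$d_{\beta_{(1/2)}}^{\sqrt V}(\nu_1\mathcal P,\nu_2\mathcal P)\le\bar\alpha_{(1/2)}\,d_{\beta_{(1/2)}}^{\sqrt V}(\nu_1,\nu_2)\quad\text{for all probability measures }\nu_1,\nu_2, \qquad(*)$$ and a constant $C$ with $0<C\le\dfrac{1\vee\mu_0(V^{1/2})}{1-\bar\alpha_{(1/2)}}$ for which $\mathrm{MSE}(C)$ holds. (ii) Moreover, for every $\beta_{(1/2)}>0$ and $\bar\alpha_{(1/2)}\in(0,1)$ satisfying $(*)$, $\mathrm{MSE}(C)$ holds with $C=\dfrac{2\,(1\vee\beta_{(1/2)}^{-1})}{1-\bar\alpha_{(1/2)}}$. -/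

import Mathlib

open MeasureTheory ProbabilityTheory

universe u w

namespace PerturbedChain

variable {S : Type u} [MeasurableSpace S]

/-- Weighted total variation distance `∫ (1 + β V) d|μ - ν|` with values in `[0, ∞]`.
For `β = 0` this is the total variation metric `d₀` (with maximal value `2`). -/
noncomputable def weightedTV (β : ℝ) (V : S → ℝ) (μ ν : Measure S)
    [IsFiniteMeasure μ] [IsFiniteMeasure ν] : ENNReal :=
  ∫⁻ x, ENNReal.ofReal (1 + β * V x) ∂(μ.toSignedMeasure - ν.toSignedMeasure).totalVariation

/-- Foster-Lyapunov drift condition `P V ≤ γ V + K`; finiteness of `P V` is part of it. -/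
def LyapunovDrift (P : Kernel S S) (V : S → ℝ) (γ K : ℝ) : Prop :=
  ∀ x, Integrable V (P x) ∧ ∫ y, V y ∂(P x) ≤ γ * V x + K

/-- Every sublevel set of `V` is small, in the sense of total variation. -/
def SmallSublevelSets (P : Kernel S S) [IsMarkovKernel P] (V : S → ℝ) : Prop :=
  ∀ R : ℝ, 0 < R → ∃ α : ℝ, 0 < α ∧ α < 1 ∧
    ∀ x y, V x ≤ R → V y ≤ R → weightedTV 0 V (P x) (P y) ≤ ENNReal.ofReal (2 * α)

/-- `P` contracts the `V`-weighted total variation distance with parameter `β` between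
probability measures by the factor `α`. -/
def Contracts (P : Kernel S S) [IsMarkovKernel P] (V : S → ℝ) (β α : ℝ) : Prop :=
  ∀ (ν₁ ν₂ : Measure S) [IsProbabilityMeasure ν₁] [IsProbabilityMeasure ν₂],
    weightedTV β V (P ∘ₘ ν₁) (P ∘ₘ ν₂) ≤ ENNReal.ofReal α * weightedTV β V ν₁ ν₂

/-- `d₁(δ_x P, δ_x Q) ≤ ε (1 + δ V(x))` for all `x`. -/
def WeightedClose (P Q : Kernel S S) [IsMarkovKernel P] [IsMarkovKernel Q]
    (V : S → ℝ) (ε δ : ℝ) : Prop :=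
  ∀ x, weightedTV 1 V (P x) (Q x) ≤ ENNReal.ofReal (ε * (1 + δ * V x))

/-- `X` is a Markov chain on the probability space `(Ω, Pr)` with transition kernel `Q` started at
`x₀`: the conditional distribution of `X (n + 1)` given `(X 0, …, X n)` is `Q (X n)`. -/
structure IsMarkovChainFrom {Ω : Type w} [MeasurableSpace Ω] (Pr : Measure Ω)
    (Q : Kernel S S) (x₀ : S) (X : ℕ → Ω → S) : Prop where
  init : HasLaw (X 0) (Measure.dirac x₀) Pr
  step : ∀ n : ℕ, HasCondDistrib (X (n + 1)) (fun ω (i : Fin (n + 1)) => X i ω)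
    (Q.comap (fun h : Fin (n + 1) → S => h (Fin.last n)) (measurable_pi_apply _)) Pr

/-- The mean-square error bound with constant `C`, for all approximating kernels `Pε`, all initial
points and all test functions bounded by `√V`. The function `D` is the implied constant of the
`O(1/n²)` term; it depends on `(Pε, ε, δ, x₀, φ)` only through `γε`, `Kε` and `V x₀`. -/
def MeanSquareErrorBound (P : Kernel S S) [IsMarkovKernel P] (V : S → ℝ) (μ₀ : Measure S)
    (C : ℝ) : Prop :=
  ∃ D : ℝ → ℝ → ℝ → ℝ,
    ∀ δ γε Kε : ℝ, 0 ≤ δ → 0 < γε → γε < 1 → 0 < Kε →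
    ∃ c₀ c₁ : ℝ,
      c₀ ≤ 2 + 5 * (max δ √δ * max Kε √Kε) / (1 - √γε) ^ 2 ∧
      c₁ = 2 + √Kε / (1 - √γε) ∧
      ∀ (ε : ℝ) (Pε : Kernel S S) [IsMarkovKernel Pε], 0 ≤ ε →
        WeightedClose P Pε V ε δ → LyapunovDrift Pε V γε Kε →
        ∀ (Ω : Type w) [MeasurableSpace Ω] (Pr : Measure Ω) [IsProbabilityMeasure Pr]
          (x₀ : S) (X : ℕ → Ω → S), IsMarkovChainFrom Pr Pε x₀ X →
        ∀ φ : S → ℝ, Measurable φ → (∀ x, |φ x| ≤ √(V x)) →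
        ∀ n : ℕ, 1 ≤ n →
          Integrable (fun ω => ((1 / (n : ℝ)) * ∑ k ∈ Finset.range n, φ (X k ω)
            - ∫ x, φ x ∂μ₀) ^ 2) Pr ∧
          ∫ ω, ((1 / (n : ℝ)) * ∑ k ∈ Finset.range n, φ (X k ω) - ∫ x, φ x ∂μ₀) ^ 2 ∂Pr
            ≤ 3 * C ^ 2 * ε * c₀
              + 3 * C ^ 2 / n *
                (2 + 2 * Kε / (1 - γε) + ε * δ * c₁ * V x₀ / (1 - √γε))
              + D γε Kε (V x₀) / (n : ℝ) ^ 2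

end PerturbedChain

/-!
Two facts carry everything: `P` contracts a weighted total variation distance, and the ergodic
averages of any chain are controlled by the Poisson equation for `P`.

*Contraction.* By the Jordan decomposition, `weightedTV β V μ ν` is the integral of `1 + β V`
against `(μ - ν) + (ν - μ)` with truncated differences of measures. Its dual form says that `P`
shrinks the oscillation of functions relative to the weight, where a bound
`|h x - h y| ≤ a x + a y` is the same as `|h - c| ≤ a` for some constant `c`
(`exists_abs_sub_le_of_forall_abs_sub_le`). This passage between oscillations and bounds
replaces any coupling or measurable selection: a contraction for Dirac masses extends to all
probability measures (`contracts_of_forall_dirac`), and for Dirac masses it follows from the drift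
condition far out and from the overlap of the transition probabilities on sublevel sets
(`exists_contracts`). Both hypotheses pass from `V` to `√V`.

*Invariant measure.* The laws `δₓ Pⁿ` form a sequence of finite length, hence converge
(`exists_tendsto_lintegral_of_tsum_weightedTV_ne_top`), and the limit is invariant. Every invariant
probability measure agrees with it on sets, since `Pⁿ 1_A` converges pointwise to a constant
(`eq_of_invariant_of_contracts`).

*Mean-square error.* For `|φ| ≤ √V` the `√V`-contraction gives a solution of `ψ - P ψ = φ - μ₀ φ`
with `|ψ| ≤ A (1 + √V)`, `A = (1 ∨ βh⁻¹) / (1 - αh)` (`exists_poisson_solution`). Along a chain with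
kernel `Q`, `∑ (φ(X_k) - μ₀ φ)` is the sum of the boundary term `ψ(X₀) - ψ(Xₙ)`, a martingale, and
`∑ ((Q - P) ψ)(X_k)`. The boundary term is `O(1)` in mean square, the martingale increments are
orthogonal with variances at most `2 A² (1 + E V)`, and `|(Q - P) ψ|² ≤ 4 A² ε (1 + δ V)` by the
Cauchy-Schwarz inequality (`weightedTV_sqrt_le`). With `C = 2 A` these estimates add up to the
claimed bound (`meanSquareErrorBound_of_poisson`).

This holds for every `√V`-contraction. In the existence part the constant is again `C = 2 A` for one
such contraction. A contraction with factor `αh` is one with every larger factor, and the reported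
factor is `1 - C⁻¹ ≥ αh`, for which `C = 1 / (1 - (1 - C⁻¹))` satisfies the required upper bound.
-/

namespace PerturbedChain

/-! ### Weighted total variation distance -/

/-- A bound on the oscillation of `h` by a weight `a` bounds `h` itself up to a constant. -/
lemma exists_abs_sub_le_of_forall_abs_sub_le {S : Type*} [Nonempty S] {h a : S → ℝ}
    (H : ∀ x y, |h x - h y| ≤ a x + a y) : ∃ c, ∀ x, |h x - c| ≤ a x := by
  have hb : ∀ x y, h x - a x ≤ h y + a y := fun x y => by
    have := (abs_le.1 (H x y)).2
    linarith
  have hbdd : BddAbove (Set.range fun x => h x - a x) := by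
    obtain ⟨y⟩ := ‹Nonempty S›
    exact ⟨h y + a y, by rintro _ ⟨x, rfl⟩; exact hb x y⟩
  refine ⟨⨆ x, (h x - a x), fun x => abs_le.2 ⟨?_, ?_⟩⟩
  · have : ⨆ x, (h x - a x) ≤ h x + a x := ciSup_le fun z => hb z x
    linarith
  · have := le_ciSup hbdd x
    linarith

section WeightedTotalVariation

variable {S : Type*} [MeasurableSpace S]

lemma add_sub_comm_of_isFiniteMeasure (μ ν : Measure S) [IsFiniteMeasure μ] [IsFiniteMeasure ν] :
    μ + (ν - μ) = ν + (μ - ν) := by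
  have h := Measure.sub_toSignedMeasure_eq_toSignedMeasure_sub (μ := μ) (ν := ν)
  rw [← Measure.toSignedMeasure_eq_toSignedMeasure_iff, Measure.toSignedMeasure_add,
    Measure.toSignedMeasure_add]
  rw [sub_eq_sub_iff_add_eq_add] at h
  rw [h, add_comm]

lemma weightedTV_eq_lintegral_sub_add (β : ℝ) (V : S → ℝ) (μ ν : Measure S)
    [IsFiniteMeasure μ] [IsFiniteMeasure ν] :
    weightedTV β V μ ν = ∫⁻ x, ENNReal.ofReal (1 + β * V x) ∂(μ - ν)
      + ∫⁻ x, ENNReal.ofReal (1 + β * V x) ∂(ν - μ) := by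
  rw [weightedTV, SignedMeasure.totalVariation, Measure.toJordanDecomposition_toSignedMeasure_sub,
    Measure.jordanDecompositionOfToSignedMeasureSub_posPart,
    Measure.jordanDecompositionOfToSignedMeasureSub_negPart, lintegral_add_measure]

lemma weightedTV_congr {β : ℝ} {V : S → ℝ} {μ ν μ' ν' : Measure S}
    [IsFiniteMeasure μ] [IsFiniteMeasure ν] [IsFiniteMeasure μ'] [IsFiniteMeasure ν']
    (hμ : μ = μ') (hν : ν = ν') : weightedTV β V μ ν = weightedTV β V μ' ν' := by
  subst hμ hν
  rfl

lemma weightedTV_le_lintegral_add (β : ℝ) (V : S → ℝ) (μ ν : Measure S)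
    [IsFiniteMeasure μ] [IsFiniteMeasure ν] :
    weightedTV β V μ ν ≤ ∫⁻ x, ENNReal.ofReal (1 + β * V x) ∂μ
      + ∫⁻ x, ENNReal.ofReal (1 + β * V x) ∂ν := by
  rw [weightedTV_eq_lintegral_sub_add]
  exact add_le_add (lintegral_mono' Measure.sub_le le_rfl) (lintegral_mono' Measure.sub_le le_rfl)

lemma weightedTV_le_integral_add {β : ℝ} {V : S → ℝ} (hβ : 0 ≤ β) (hV : ∀ x, 0 ≤ V x)
    {μ ν : Measure S} [IsProbabilityMeasure μ] [IsProbabilityMeasure ν]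
    (hμ : Integrable V μ) (hν : Integrable V ν) :
    weightedTV β V μ ν ≤ ENNReal.ofReal (2 + β * (∫ x, V x ∂μ + ∫ x, V x ∂ν)) := by
  refine (weightedTV_le_lintegral_add β V μ ν).trans_eq ?_
  have hw : ∀ x, 0 ≤ 1 + β * V x := fun x => by have := mul_nonneg hβ (hV x); linarith
  have key : ∀ (ρ : Measure S) [IsProbabilityMeasure ρ], Integrable V ρ →
      ∫⁻ x, ENNReal.ofReal (1 + β * V x) ∂ρ = ENNReal.ofReal (1 + β * ∫ x, V x ∂ρ) := by
    intro ρ _ hρ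
    have hi : Integrable (fun x => 1 + β * V x) ρ := (integrable_const _).add (hρ.const_mul β)
    rw [← ofReal_integral_eq_lintegral_ofReal hi (ae_of_all _ hw),
      integral_add (integrable_const _) (hρ.const_mul β), integral_const_mul]
    simp
  have h1 := mul_nonneg hβ (integral_nonneg (μ := μ) hV)
  have h2 := mul_nonneg hβ (integral_nonneg (μ := ν) hV)
  rw [key μ hμ, key ν hν, ← ENNReal.ofReal_add (by linarith) (by linarith)]
  congr 1
  ring

/-- Splitting the weight `1 + β V` inside the distance: the mass of `|μ - ν|` is measured by `d₀`,
and the `V`-part is at most `β ∫ V d(μ + ν)`. -/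
lemma weightedTV_le_weightedTV_zero_add {β : ℝ} {V : S → ℝ} (hβ : 0 ≤ β) (hV : ∀ x, 0 ≤ V x)
    (hVm : Measurable V)
    {μ ν : Measure S} [IsFiniteMeasure μ] [IsFiniteMeasure ν]
    (hμ : Integrable V μ) (hν : Integrable V ν) :
    weightedTV β V μ ν ≤ weightedTV 0 V μ ν
      + ENNReal.ofReal (β * (∫ x, V x ∂μ + ∫ x, V x ∂ν)) := by
  have h0 : ∀ x, 0 ≤ β * V x := fun x => mul_nonneg hβ (hV x)
  have key : ∀ ρ ρ' : Measure S, ρ ≤ ρ' → Integrable V ρ' →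
      ∫⁻ x, ENNReal.ofReal (1 + β * V x) ∂ρ
        ≤ ∫⁻ x, ENNReal.ofReal (1 + 0 * V x) ∂ρ + ENNReal.ofReal (β * ∫ x, V x ∂ρ') := by
    intro ρ ρ' hρ hi
    rw [← integral_const_mul, ofReal_integral_eq_lintegral_ofReal (hi.const_mul β) (ae_of_all _ h0)]
    refine le_trans (le_of_eq ?_) (add_le_add le_rfl (lintegral_mono' hρ le_rfl))
    rw [← lintegral_add_right _ (hVm.const_mul β).ennreal_ofReal]
    refine lintegral_congr fun x => ?_
    rw [ENNReal.ofReal_add zero_le_one (h0 x)]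
    simp
  rw [weightedTV_eq_lintegral_sub_add, weightedTV_eq_lintegral_sub_add, mul_add,
    ENNReal.ofReal_add (mul_nonneg hβ (integral_nonneg hV)) (mul_nonneg hβ (integral_nonneg hV))]
  refine (add_le_add (key _ _ Measure.sub_le hμ) (key _ _ Measure.sub_le hν)).trans (le_of_eq ?_)
  ring

lemma integrable_of_lintegral_weight_ne_top {β L : ℝ} {V h : S → ℝ} {μ : Measure S}
    (hh : Measurable h) (hb : ∀ x, |h x| ≤ L * (1 + β * V x))
    (hfin : ∫⁻ x, ENNReal.ofReal (1 + β * V x) ∂μ ≠ ⊤) (hL : 0 ≤ L) : Integrable h μ := by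
  refine ⟨hh.aestronglyMeasurable, ?_⟩
  rw [hasFiniteIntegral_iff_norm]
  calc ∫⁻ x, ENNReal.ofReal ‖h x‖ ∂μ
      ≤ ∫⁻ x, ENNReal.ofReal L * ENNReal.ofReal (1 + β * V x) ∂μ := by
        refine lintegral_mono fun x => ?_
        rw [← ENNReal.ofReal_mul hL]
        exact ENNReal.ofReal_le_ofReal (hb x)
    _ = ENNReal.ofReal L * ∫⁻ x, ENNReal.ofReal (1 + β * V x) ∂μ :=
        lintegral_const_mul' _ _ ENNReal.ofReal_ne_top
    _ < ⊤ := ENNReal.mul_lt_top ENNReal.ofReal_lt_top hfin.lt_top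

/-- The dual bound: a function dominated by a multiple of the weight integrates differently
against `μ` and `ν` by at most that multiple of the weighted distance. -/
lemma abs_integral_sub_integral_le {β L D : ℝ} {V h : S → ℝ} (hV : ∀ x, 0 ≤ V x)
    (hVm : Measurable V) (hβ : 0 ≤ β) (hL : 0 ≤ L)
    {μ ν : Measure S} [IsFiniteMeasure μ] [IsFiniteMeasure ν]
    (hD : 0 ≤ D) (hb : ∀ x, |h x| ≤ L * (1 + β * V x))
    (hμ : Integrable h μ) (hν : Integrable h ν)
    (hTV : weightedTV β V μ ν ≤ ENNReal.ofReal D) :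
    |∫ x, h x ∂μ - ∫ x, h x ∂ν| ≤ L * D := by
  have hw : ∀ x, 0 ≤ 1 + β * V x := fun x => by have := mul_nonneg hβ (hV x); linarith
  have hwm : Measurable fun x => 1 + β * V x := (hVm.const_mul β).const_add 1
  rw [weightedTV_eq_lintegral_sub_add] at hTV
  have hp : ∫⁻ x, ENNReal.ofReal (1 + β * V x) ∂(μ - ν) ≠ ⊤ :=
    ne_top_of_le_ne_top ENNReal.ofReal_ne_top (le_self_add.trans hTV)
  have hq : ∫⁻ x, ENNReal.ofReal (1 + β * V x) ∂(ν - μ) ≠ ⊤ :=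
    ne_top_of_le_ne_top ENNReal.ofReal_ne_top (le_add_self.trans hTV)
  have hwp : Integrable (fun x => 1 + β * V x) (μ - ν) :=
    integrable_of_lintegral_weight_ne_top (L := 1) hwm
      (fun x => by rw [abs_of_nonneg (hw x), one_mul]) hp zero_le_one
  have hwq : Integrable (fun x => 1 + β * V x) (ν - μ) :=
    integrable_of_lintegral_weight_ne_top (L := 1) hwm
      (fun x => by rw [abs_of_nonneg (hw x), one_mul]) hq zero_le_one
  have hhp : Integrable h (μ - ν) := hμ.mono_measure Measure.sub_le
  have hhq : Integrable h (ν - μ) := hν.mono_measure Measure.sub_le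
  have e : ∫ x, h x ∂μ + ∫ x, h x ∂(ν - μ) = ∫ x, h x ∂ν + ∫ x, h x ∂(μ - ν) := by
    rw [← integral_add_measure hμ hhq, ← integral_add_measure hν hhp,
      add_sub_comm_of_isFiniteMeasure]
  have bound : ∀ ρ : Measure S, Integrable (fun x => 1 + β * V x) ρ → Integrable h ρ →
      |∫ x, h x ∂ρ| ≤ L * ∫ x, (1 + β * V x) ∂ρ := fun ρ h1 h2 => by
    rw [← integral_const_mul]
    exact (abs_integral_le_integral_abs).trans (integral_mono h2.abs (h1.const_mul L) hb)
  have b1 := bound _ hwp hhp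
  have b2 := bound _ hwq hhq
  have hsum : ∫ x, (1 + β * V x) ∂(μ - ν) + ∫ x, (1 + β * V x) ∂(ν - μ) ≤ D := by
    rw [← ofReal_integral_eq_lintegral_ofReal hwp (ae_of_all _ hw),
      ← ofReal_integral_eq_lintegral_ofReal hwq (ae_of_all _ hw),
      ← ENNReal.ofReal_add (integral_nonneg hw) (integral_nonneg hw)] at hTV
    exact (ENNReal.ofReal_le_ofReal_iff hD).1 hTV
  have e' : ∫ x, h x ∂μ - ∫ x, h x ∂ν = ∫ x, h x ∂(μ - ν) - ∫ x, h x ∂(ν - μ) := by linarith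
  rw [e']
  calc |∫ x, h x ∂(μ - ν) - ∫ x, h x ∂(ν - μ)|
      ≤ |∫ x, h x ∂(μ - ν)| + |∫ x, h x ∂(ν - μ)| := abs_sub _ _
    _ ≤ L * (∫ x, (1 + β * V x) ∂(μ - ν) + ∫ x, (1 + β * V x) ∂(ν - μ)) := by linarith
    _ ≤ L * D := mul_le_mul_of_nonneg_left hsum hL

end WeightedTotalVariation


/-! ### Contraction of the weighted distance -/

section Contraction

variable {S : Type*} [MeasurableSpace S]

lemma integral_kernel_comp_measure {P : Kernel S S} {ρ : Measure S} {f : S → ℝ}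
    (hf : Integrable f (P ∘ₘ ρ)) : ∫ x, f x ∂(P ∘ₘ ρ) = ∫ x, ∫ y, f y ∂(P x) ∂ρ := by
  rw [Measure.comp_eq_comp_const_apply] at hf ⊢
  rw [Kernel.integral_comp hf]
  simp

lemma LyapunovDrift.integrable_comp {P : Kernel S S} {V : S → ℝ} {γ K : ℝ}
    (hP : LyapunovDrift P V γ K) (hVm : Measurable V) (hV : ∀ x, 0 ≤ V x)
    {ρ : Measure S} [IsFiniteMeasure ρ] (hρ : Integrable V ρ) : Integrable V (P ∘ₘ ρ) := by
  rw [Measure.integrable_comp_iff hVm.aestronglyMeasurable]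
  refine ⟨ae_of_all _ fun x => (hP x).1, ?_⟩
  have hi : Integrable (fun x => γ * V x + K) ρ := (hρ.const_mul γ).add (integrable_const K)
  refine hi.mono' (hVm.norm.stronglyMeasurable.integral_kernel.aestronglyMeasurable)
    (ae_of_all _ fun x => ?_)
  simp only [Real.norm_of_nonneg (hV _)]
  rw [Real.norm_of_nonneg (integral_nonneg hV)]
  exact (hP x).2

/-- A contraction for pairs of Dirac masses extends to all pairs of probability measures.
The distance of `ν₁ P` and `ν₂ P` is the integral of the test function `h = ±(1 + β V)`, with signs
from a Hahn decomposition; the function `P h` has the same modulus of oscillation as in the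
Dirac case, so that, up to a constant, it is dominated by `α (1 + β V)`. -/
lemma contracts_of_forall_dirac [Nonempty S] {P : Kernel S S} [IsMarkovKernel P] {V : S → ℝ}
    (hVm : Measurable V) (hV : ∀ x, 0 ≤ V x) {γ K : ℝ} (hP : LyapunovDrift P V γ K)
    {β α : ℝ} (hβ : 0 ≤ β) (hα : 0 < α)
    (H : ∀ x y, weightedTV β V (P x) (P y)
      ≤ ENNReal.ofReal (α * (1 + β * V x) + α * (1 + β * V y))) :
    Contracts P V β α := by
  intro ν₁ ν₂ _ _
  by_cases htop : weightedTV β V ν₁ ν₂ = ⊤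
  · rw [htop, ENNReal.mul_top (by simpa using hα)]
    exact le_top
  have hw1 : ∀ x, 1 ≤ 1 + β * V x := fun x => by have := mul_nonneg hβ (hV x); linarith
  have hw : ∀ x, 0 ≤ 1 + β * V x := fun x => zero_le_one.trans (hw1 x)
  have hwm : Measurable fun x => 1 + β * V x := (hVm.const_mul β).const_add 1
  set w : S → ℝ := fun x => 1 + β * V x with hwdef
  set p := ν₁ - ν₂ with hp
  set q := ν₂ - ν₁ with hq
  set μ₁ := P ∘ₘ ν₁ with hμ₁
  set μ₂ := P ∘ₘ ν₂ with hμ₂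
  rw [weightedTV_eq_lintegral_sub_add] at htop ⊢
  rw [weightedTV_eq_lintegral_sub_add]
  obtain ⟨htp, htq⟩ := ENNReal.add_ne_top.1 htop
  have hwint : ∀ ρ : Measure S, ∫⁻ x, ENNReal.ofReal (1 + β * V x) ∂ρ ≠ ⊤ →
      Integrable w ρ := fun ρ h =>
    integrable_of_lintegral_weight_ne_top (L := 1) hwm
      (fun x => by rw [abs_of_nonneg (hw x), one_mul]) h zero_le_one
  have hwp : Integrable w p := hwint p htp
  have hwq : Integrable w q := hwint q htq
  -- The kernel maps the two Jordan parts to measures with the same difference `μ₁ - μ₂`.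
  have hpq : ν₁ + q = ν₂ + p := add_sub_comm_of_isFiniteMeasure ν₁ ν₂
  have hPpq : μ₁ + P ∘ₘ q = μ₂ + P ∘ₘ p := by
    rw [hμ₁, hμ₂, ← Measure.comp_add, ← Measure.comp_add, hpq]
  have hwP : ∀ ρ : Measure S, IsFiniteMeasure ρ → Integrable w ρ → Integrable w (P ∘ₘ ρ) := by
    intro ρ _ hρ
    by_cases hβ0 : β = 0
    · simp only [hwdef, hβ0, zero_mul]
      exact integrable_const _
    have hVρ : Integrable V ρ := by
      have := (hρ.sub (integrable_const 1)).const_mul β⁻¹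
      refine this.congr (ae_of_all _ fun x => ?_)
      simp only [hwdef, Pi.sub_apply]
      field_simp
      ring
    exact (integrable_const _).add ((hP.integrable_comp hVm hV hVρ).const_mul β)
  have hwPp := hwP p inferInstance hwp
  have hwPq := hwP q inferInstance hwq
  have hle1 : μ₁ - μ₂ ≤ P ∘ₘ p := by
    refine Measure.sub_le_of_le_add ?_
    rw [add_comm, ← hPpq]
    exact Measure.le_add_right le_rfl
  have hle2 : μ₂ - μ₁ ≤ P ∘ₘ q := by
    refine Measure.sub_le_of_le_add ?_
    rw [add_comm, hPpq]
    exact Measure.le_add_right le_rfl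
  obtain ⟨s, hs⟩ := exists_isHahnDecomposition μ₁ μ₂
  have hs1 : (μ₁ - μ₂) s = 0 := Measure.sub_apply_eq_zero_of_isHahnDecomposition hs
  have hs2 : (μ₂ - μ₁) sᶜ = 0 := Measure.sub_apply_eq_zero_of_isHahnDecomposition hs.compl
  classical
  set h : S → ℝ := fun x => if x ∈ s then -w x else w x with hh
  have hhm : Measurable h := Measurable.ite hs.measurableSet hwm.neg hwm
  have habs : ∀ x, |h x| ≤ 1 * (1 + β * V x) := fun x => by
    simp only [hh]
    split_ifs
    · rw [abs_neg, abs_of_nonneg (hw x), one_mul]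
    · rw [abs_of_nonneg (hw x), one_mul]
  have hhint : ∀ ρ : Measure S, Integrable w ρ → Integrable h ρ := fun ρ hρ =>
    hρ.mono' hhm.aestronglyMeasurable (ae_of_all _ fun x => by simpa [hwdef] using habs x)
  have e1 : ∫ x, h x ∂(μ₁ - μ₂) = ∫ x, w x ∂(μ₁ - μ₂) := by
    refine integral_congr_ae ?_
    have : ∀ᵐ x ∂(μ₁ - μ₂), x ∉ s := measure_eq_zero_iff_ae_notMem.1 hs1
    filter_upwards [this] with x hx
    simp [hh, hx]
  have e2 : ∫ x, h x ∂(μ₂ - μ₁) = -∫ x, w x ∂(μ₂ - μ₁) := by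
    rw [← integral_neg]
    refine integral_congr_ae ?_
    have : ∀ᵐ x ∂(μ₂ - μ₁), x ∉ sᶜ := measure_eq_zero_iff_ae_notMem.1 hs2
    filter_upwards [this] with x hx
    simp only [Set.mem_compl_iff, not_not] at hx
    simp [hh, hx]
  -- Both sides agree after adding the finite measure `μ₁ + μ₂`.
  have hPeq : (μ₁ - μ₂) + P ∘ₘ q = (μ₂ - μ₁) + P ∘ₘ p := by
    have a := add_sub_comm_of_isFiniteMeasure μ₁ μ₂
    ext t ht
    have b := congrArg (fun m : Measure S => m t) a
    have c := congrArg (fun m : Measure S => m t) hPpq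
    simp only [Measure.add_apply] at b c ⊢
    have f1 := measure_ne_top μ₁ t
    have f2 := measure_ne_top μ₂ t
    have f3 := measure_ne_top (μ₁ - μ₂) t
    have f4 := measure_ne_top (μ₂ - μ₁) t
    have f5 := measure_ne_top (P ∘ₘ p) t
    have f6 := measure_ne_top (P ∘ₘ q) t
    lift μ₁ t to NNReal using f1 with a1
    lift μ₂ t to NNReal using f2 with a2
    lift (μ₁ - μ₂) t to NNReal using f3 with a3
    lift (μ₂ - μ₁) t to NNReal using f4 with a4
    lift (P ∘ₘ p) t to NNReal using f5 with a5
    lift (P ∘ₘ q) t to NNReal using f6 with a6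
    norm_cast at b c ⊢
    rw [← NNReal.coe_inj] at b c ⊢
    push_cast at b c ⊢
    linarith
  have hw1' : Integrable w (μ₁ - μ₂) := hwPp.mono_measure hle1
  have hw2' : Integrable w (μ₂ - μ₁) := hwPq.mono_measure hle2
  have e3 : ∫ x, h x ∂(μ₁ - μ₂) - ∫ x, h x ∂(μ₂ - μ₁)
      = ∫ x, h x ∂(P ∘ₘ p) - ∫ x, h x ∂(P ∘ₘ q) := by
    have := congrArg (fun m : Measure S => ∫ x, h x ∂m) hPeq
    rw [integral_add_measure (hhint _ hw1') (hhint _ hwPq),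
      integral_add_measure (hhint _ hw2') (hhint _ hwPp)] at this
    linarith
  have hmass : p.real Set.univ = q.real Set.univ := by
    have : (ν₁ + q).real Set.univ = (ν₂ + p).real Set.univ := by rw [hpq]
    rw [measureReal_add_apply, measureReal_add_apply, probReal_univ (μ := ν₁),
      probReal_univ (μ := ν₂)] at this
    linarith
  have hPh : ∀ ρ : Measure S, Integrable h (P ∘ₘ ρ) → Integrable (fun x => ∫ y, h y ∂(P x)) ρ := by
    intro ρ hρ
    have := ((Measure.integrable_comp_iff hhm.aestronglyMeasurable).1 hρ).2
    refine this.mono' hhm.stronglyMeasurable.integral_kernel.aestronglyMeasurable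
      (ae_of_all _ fun x => norm_integral_le_integral_norm _)
  have hwPx : ∀ x, Integrable w (P x) := fun x =>
    (integrable_const _).add ((hP x).1.const_mul β)
  obtain ⟨c, hc⟩ := exists_abs_sub_le_of_forall_abs_sub_le
    (h := fun x => ∫ y, h y ∂(P x)) (a := fun x => α * w x) fun x y => by
      have := abs_integral_sub_integral_le hV hVm hβ zero_le_one
        (add_nonneg (mul_nonneg hα.le (hw x)) (mul_nonneg hα.le (hw y))) habs
        (hhint _ (hwPx x)) (hhint _ (hwPx y)) (H x y)
      simpa using this
  have hip := hPh p (hhint _ hwPp)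
  have hiq := hPh q (hhint _ hwPq)
  have bp : ∫ x, (∫ y, h y ∂(P x)) ∂p ≤ α * ∫ x, w x ∂p + c * p.real Set.univ := by
    have h1 : ∫ x, (∫ y, h y ∂(P x)) ∂p ≤ ∫ x, (α * w x + c) ∂p :=
      integral_mono hip ((hwp.const_mul α).add (integrable_const c)) fun x => by
        have := (abs_le.1 (hc x)).2
        simp only at this ⊢
        linarith
    rw [integral_add (hwp.const_mul α) (integrable_const c), integral_const_mul, integral_const,
      smul_eq_mul, mul_comm _ c] at h1
    exact h1
  have bq : -(α * ∫ x, w x ∂q) + c * q.real Set.univ ≤ ∫ x, (∫ y, h y ∂(P x)) ∂q := by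
    have hn : Integrable (fun x => -(α * w x)) q := (hwq.const_mul α).neg
    have h1 : ∫ x, (-(α * w x) + c) ∂q ≤ ∫ x, (∫ y, h y ∂(P x)) ∂q :=
      integral_mono (hn.add (integrable_const c)) hiq fun x => by
        have := (abs_le.1 (hc x)).1
        simp only at this ⊢
        linarith
    rw [integral_add hn (integrable_const c), integral_neg, integral_const_mul,
      integral_const, smul_eq_mul, mul_comm _ c] at h1
    exact h1
  rw [integral_kernel_comp_measure (hhint _ hwPp), integral_kernel_comp_measure (hhint _ hwPq),
    e1, e2] at e3
  rw [← ofReal_integral_eq_lintegral_ofReal hw1' (ae_of_all _ hw),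
    ← ofReal_integral_eq_lintegral_ofReal hw2' (ae_of_all _ hw),
    ← ofReal_integral_eq_lintegral_ofReal hwp (ae_of_all _ hw),
    ← ofReal_integral_eq_lintegral_ofReal hwq (ae_of_all _ hw),
    ← ENNReal.ofReal_add (integral_nonneg hw) (integral_nonneg hw),
    ← ENNReal.ofReal_add (integral_nonneg hw) (integral_nonneg hw),
    ← ENNReal.ofReal_mul hα.le]
  refine ENNReal.ofReal_le_ofReal ?_
  rw [hmass] at bp
  linarith

lemma Contracts.weightedTV_le {P : Kernel S S} [IsMarkovKernel P] {V : S → ℝ}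
    (hVm : Measurable V) (hV : ∀ x, 0 ≤ V x) {β α : ℝ} (hβ : 0 ≤ β) (hα : 0 ≤ α)
    (hP : Contracts P V β α) (x y : S) :
    weightedTV β V (P x) (P y) ≤ ENNReal.ofReal (α * ((1 + β * V x) + (1 + β * V y))) := by
  have h := hP (Measure.dirac x) (Measure.dirac y)
  rw [weightedTV_congr (Measure.dirac_bind P.measurable x) (Measure.dirac_bind P.measurable y)] at h
  refine h.trans ?_
  rw [ENNReal.ofReal_mul hα]
  gcongr
  refine (weightedTV_le_lintegral_add _ _ _ _).trans_eq ?_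
  have hwm : Measurable fun x => ENNReal.ofReal (1 + β * V x) :=
    ((hVm.const_mul β).const_add 1).ennreal_ofReal
  rw [lintegral_dirac' _ hwm, lintegral_dirac' _ hwm, ← ENNReal.ofReal_add]
  · have := mul_nonneg hβ (hV x); linarith
  · have := mul_nonneg hβ (hV y); linarith

/-- Contraction in dual form: `P` shrinks by the factor `α` the oscillation of functions relative
to the weight `1 + β V`. -/
lemma Contracts.abs_integral_sub_integral_le [Nonempty S] {P : Kernel S S} [IsMarkovKernel P]
    {V : S → ℝ} (hVm : Measurable V) (hV : ∀ x, 0 ≤ V x) {β α : ℝ} (hβ : 0 ≤ β) (hα : 0 ≤ α)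
    (hP : Contracts P V β α) {h : S → ℝ} {L : ℝ} (hL : 0 ≤ L)
    (hi : ∀ x, Integrable h (P x))
    (hosc : ∀ x y, |h x - h y| ≤ L * (1 + β * V x) + L * (1 + β * V y)) (x y : S) :
    |∫ z, h z ∂(P x) - ∫ z, h z ∂(P y)| ≤ α * L * (1 + β * V x) + α * L * (1 + β * V y) := by
  obtain ⟨c, hc⟩ := exists_abs_sub_le_of_forall_abs_sub_le hosc
  have hw : ∀ x, 0 ≤ 1 + β * V x := fun x => by have := mul_nonneg hβ (hV x); linarith
  have := PerturbedChain.abs_integral_sub_integral_le hV hVm hβ hL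
    (mul_nonneg hα (add_nonneg (hw x) (hw y))) hc
    ((hi x).sub (integrable_const c)) ((hi y).sub (integrable_const c))
    (hP.weightedTV_le hVm hV hβ hα x y)
  rw [integral_sub (hi x) (integrable_const c), integral_sub (hi y) (integrable_const c)] at this
  simp only [integral_const, probReal_univ, one_smul, sub_sub_sub_cancel_right] at this
  exact this.trans (le_of_eq (by ring))

lemma Contracts.mono {P : Kernel S S} [IsMarkovKernel P] {V : S → ℝ} {β α α' : ℝ}
    (hP : Contracts P V β α) (h : α ≤ α') : Contracts P V β α' := fun ν₁ ν₂ _ _ =>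
  (hP ν₁ ν₂).trans (mul_le_mul_left (ENNReal.ofReal_le_ofReal h) _)

/-- Harris' theorem in the form of Hairer and Mattingly: a drift condition and small sublevel sets
give a contraction of the weighted distance for all sufficiently small `β`. Pairs with
`V x + V y ≥ R` are contracted by the drift, all others by the overlap of `P x` and `P y`. -/
lemma exists_contracts [Nonempty S] {P : Kernel S S} [IsMarkovKernel P] {V : S → ℝ}
    (hVm : Measurable V) (hV : ∀ x, 0 ≤ V x) {γ K : ℝ} (hγ0 : 0 < γ) (hγ1 : γ < 1) (hK : 0 < K)
    (hP : LyapunovDrift P V γ K) (hsmall : SmallSublevelSets P V) :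
    ∃ β₀ > 0, ∀ β, 0 < β → β ≤ β₀ → ∃ α, 0 < α ∧ α < 1 ∧ Contracts P V β α := by
  have hg : 0 < 1 - γ := by linarith
  -- For `V x + V y ≥ R` the drift gives `2 K ≤ (1 - γ) (V x + V y) / 2`, half of its gain.
  set R : ℝ := 4 * K / (1 - γ) with hR
  have hR0 : 0 < R := by positivity
  have hRg : R * (1 - γ) = 4 * K := by rw [hR]; field_simp
  obtain ⟨a, ha0, ha1, ha⟩ := hsmall R hR0
  -- With this `β`, the drift constant `2 β K` uses up at most half of the gain `2 (1 - a)` made on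
  -- sublevel sets.
  refine ⟨(1 - a) / (2 * K), div_pos (by linarith) (by positivity), fun β hβ hβ₀ => ?_⟩
  have hβK : 2 * (β * K) ≤ 1 - a := by
    rw [le_div_iff₀ (by positivity)] at hβ₀
    linarith
  -- The first bound on `η = 1 - α` serves pairs with small `V`, the second one pairs far out.
  set η : ℝ := min ((1 - a) / 2) (2 * K * β / (2 + β * R)) with hη
  have hβR : 0 < β * R := by positivity
  have hη0 : 0 < η := lt_min (by linarith) (by positivity)
  have hη1 : η ≤ (1 - a) / 2 := min_le_left _ _
  have hη2 : η * (2 + β * R) ≤ 2 * K * β := by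
    rw [← le_div_iff₀ (by positivity)]
    exact min_le_right _ _
  have hη3 : 2 * η ≤ 1 - γ := by
    have h1 : 2 * η * (β * R) ≤ (1 - γ) * (β * R) := by nlinarith
    exact le_of_mul_le_mul_right h1 hβR
  refine ⟨1 - η, by linarith, by linarith, ?_⟩
  refine contracts_of_forall_dirac hVm hV hP hβ.le (by linarith) fun x y => ?_
  have hx := (hP x).2
  have hy := (hP y).2
  have hVx := hV x
  have hVy := hV y
  by_cases hs : R ≤ V x + V y
  · refine (weightedTV_le_integral_add hβ.le hV (hP x).1 (hP y).1).trans
      (ENNReal.ofReal_le_ofReal ?_)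
    have h1 : β * (∫ z, V z ∂(P x) + ∫ z, V z ∂(P y)) ≤ β * (γ * (V x + V y) + 2 * K) :=
      mul_le_mul_of_nonneg_left (by linarith) hβ.le
    have h2 : 0 ≤ β * (V x + V y - R) := mul_nonneg hβ.le (by linarith)
    have h3 : 0 ≤ (1 - γ - η) * (β * (V x + V y - R)) := mul_nonneg (by linarith) h2
    have h4 : β * (R * (1 - γ)) = β * (4 * K) := by rw [hRg]
    linarith
  · have hd := ha x y (by linarith) (by linarith)
    refine (weightedTV_le_weightedTV_zero_add hβ.le hV hVm (hP x).1 (hP y).1).trans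
      ((add_le_add hd le_rfl).trans ?_)
    have hI : 0 ≤ ∫ z, V z ∂(P x) + ∫ z, V z ∂(P y) :=
      add_nonneg (integral_nonneg hV) (integral_nonneg hV)
    rw [← ENNReal.ofReal_add (by linarith) (mul_nonneg hβ.le hI)]
    refine ENNReal.ofReal_le_ofReal ?_
    have h1 : β * (∫ z, V z ∂(P x) + ∫ z, V z ∂(P y)) ≤ β * (γ * (V x + V y) + 2 * K) :=
      mul_le_mul_of_nonneg_left (by linarith) hβ.le
    have h2 : 0 ≤ (1 - γ - η) * (β * (V x + V y)) :=
      mul_nonneg (by linarith) (mul_nonneg hβ.le (by linarith))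
    linarith

end Contraction

/-! ### Passage from `V` to `√V` -/

section SquareRoot

variable {S : Type*} [MeasurableSpace S]

lemma integrable_sqrt_of_integrable {V : S → ℝ} (hVm : Measurable V) (hV : ∀ x, 0 ≤ V x)
    {μ : Measure S} [IsFiniteMeasure μ] (h : Integrable V μ) : Integrable (fun x => √(V x)) μ := by
  refine (h.add (integrable_const 1)).mono' hVm.sqrt.aestronglyMeasurable (ae_of_all _ fun x => ?_)
  rw [Real.norm_of_nonneg (Real.sqrt_nonneg _)]
  simp only [Pi.add_apply]
  nlinarith [Real.sq_sqrt (hV x), sq_nonneg (√(V x) - 1)]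

lemma integral_sqrt_le_sqrt_integral {V : S → ℝ} (hVm : Measurable V) (hV : ∀ x, 0 ≤ V x)
    {μ : Measure S} [IsProbabilityMeasure μ] (h : Integrable V μ) :
    ∫ x, √(V x) ∂μ ≤ √(∫ x, V x ∂μ) := by
  have hs := integrable_sqrt_of_integrable hVm hV h
  have := Real.strictConcaveOn_sqrt.concaveOn.le_map_integral (μ := μ) (f := V)
    Real.continuous_sqrt.continuousOn isClosed_Ici (ae_of_all _ fun x => hV x) h hs
  exact this

lemma LyapunovDrift.sqrt {P : Kernel S S} [IsMarkovKernel P] {V : S → ℝ} {γ K : ℝ}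
    (hP : LyapunovDrift P V γ K) (hVm : Measurable V) (hV : ∀ x, 0 ≤ V x)
    (hγ : 0 ≤ γ) (hK : 0 ≤ K) :
    LyapunovDrift P (fun x => √(V x)) √γ √K := fun x => by
  refine ⟨integrable_sqrt_of_integrable hVm hV (hP x).1, ?_⟩
  refine (integral_sqrt_le_sqrt_integral hVm hV (hP x).1).trans ?_
  refine (Real.sqrt_le_sqrt (hP x).2).trans ?_
  rw [← Real.sqrt_mul hγ]
  rw [Real.sqrt_le_left (by positivity)]
  have h1 := Real.sq_sqrt (mul_nonneg hγ (hV x))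
  have h2 := Real.sq_sqrt hK
  have h3 := mul_nonneg (Real.sqrt_nonneg (γ * V x)) (Real.sqrt_nonneg K)
  linarith [add_sq (√(γ * V x)) √K]

lemma SmallSublevelSets.sqrt {P : Kernel S S} [IsMarkovKernel P] {V : S → ℝ}
    (hP : SmallSublevelSets P V) : SmallSublevelSets P fun x => √(V x) := fun R hR => by
  obtain ⟨α, h0, h1, h⟩ := hP (R ^ 2) (by positivity)
  refine ⟨α, h0, h1, fun x y hx hy => ?_⟩
  have := h x y ((Real.sqrt_le_left hR.le).1 hx) ((Real.sqrt_le_left hR.le).1 hy)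
  simpa [weightedTV] using this

end SquareRoot


/-! ### Existence of the invariant measure -/

section Completeness

open Filter Topology

variable {S : Type*} [MeasurableSpace S]

/-- Completeness of the weighted distance on probability measures: a sequence of finite length
converges. The limit is `ν₀ + ∑ (νₖ₊₁ - νₖ)⁺ - ∑ (νₖ₊₁ - νₖ)⁻`. -/
lemma exists_tendsto_lintegral_of_tsum_weightedTV_ne_top {β : ℝ} (hβ : 0 ≤ β) {V : S → ℝ}
    (hV : ∀ x, 0 ≤ V x) (ν : ℕ → Measure S)
    [∀ n, IsProbabilityMeasure (ν n)]
    (h0 : ∫⁻ x, ENNReal.ofReal (1 + β * V x) ∂(ν 0) ≠ ⊤)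
    (hsum : ∑' n, weightedTV β V (ν n) (ν (n + 1)) ≠ ⊤) :
    ∃ μ : Measure S, IsProbabilityMeasure μ ∧ ∫⁻ x, ENNReal.ofReal (1 + β * V x) ∂μ ≠ ⊤ ∧
      ∀ f : S → ENNReal, (∀ x, f x ≤ 1) →
        Tendsto (fun n => ∫⁻ x, f x ∂(ν n)) atTop (𝓝 (∫⁻ x, f x ∂μ)) := by
  set a : ℕ → Measure S := fun k => ν (k + 1) - ν k with ha
  set b : ℕ → Measure S := fun k => ν k - ν (k + 1) with hb
  have hab : ∀ k, weightedTV β V (ν k) (ν (k + 1)) = ∫⁻ x, ENNReal.ofReal (1 + β * V x) ∂(b k)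
      + ∫⁻ x, ENNReal.ofReal (1 + β * V x) ∂(a k) := fun k =>
    weightedTV_eq_lintegral_sub_add _ _ _ _
  have hA : ∫⁻ x, ENNReal.ofReal (1 + β * V x) ∂(Measure.sum a) ≠ ⊤ := by
    rw [lintegral_sum_measure]
    exact ne_top_of_le_ne_top hsum (ENNReal.tsum_le_tsum fun k => by rw [hab]; exact le_add_self)
  have hB : ∫⁻ x, ENNReal.ofReal (1 + β * V x) ∂(Measure.sum b) ≠ ⊤ := by
    rw [lintegral_sum_measure]
    exact ne_top_of_le_ne_top hsum (ENNReal.tsum_le_tsum fun k => by rw [hab]; exact le_self_add)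
  have hfin : ∀ ρ : Measure S, ∫⁻ x, ENNReal.ofReal (1 + β * V x) ∂ρ ≠ ⊤ → IsFiniteMeasure ρ := by
    intro ρ hρ
    refine ⟨lt_of_le_of_lt ?_ hρ.lt_top⟩
    rw [← lintegral_one]
    refine lintegral_mono fun x => ?_
    rw [← ENNReal.ofReal_one]
    exact ENNReal.ofReal_le_ofReal (by have := mul_nonneg hβ (hV x); linarith)
  have := hfin _ hA
  have := hfin _ hB
  have hpart : ∀ (f : S → ENNReal) (n : ℕ),
      ∫⁻ x, f x ∂(ν n) + ∑ k ∈ Finset.range n, ∫⁻ x, f x ∂(b k)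
        = ∫⁻ x, f x ∂(ν 0) + ∑ k ∈ Finset.range n, ∫⁻ x, f x ∂(a k) := by
    intro f n
    induction n with
    | zero => simp
    | succ n ih =>
      have e := add_sub_comm_of_isFiniteMeasure (ν n) (ν (n + 1))
      have e' : ∫⁻ x, f x ∂(ν n) + ∫⁻ x, f x ∂(a n)
          = ∫⁻ x, f x ∂(ν (n + 1)) + ∫⁻ x, f x ∂(b n) := by
        rw [← lintegral_add_measure, ← lintegral_add_measure, e]
      rw [Finset.sum_range_succ, Finset.sum_range_succ, ← add_assoc, ← add_assoc, ← ih,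
        add_right_comm, ← e']
      ring
  have hle : Measure.sum b ≤ ν 0 + Measure.sum a := by
    refine Measure.le_iff.2 fun s hs => ?_
    rw [Measure.add_apply, Measure.sum_apply _ hs, Measure.sum_apply _ hs]
    refine ENNReal.tsum_le_of_sum_range_le fun n => ?_
    have h := hpart (s.indicator 1) n
    simp only [lintegral_indicator_one hs] at h
    exact le_add_self.trans (h.le.trans (add_le_add le_rfl (ENNReal.sum_le_tsum _)))
  set μ := ν 0 + Measure.sum a - Measure.sum b with hμ
  have hadd : μ + Measure.sum b = ν 0 + Measure.sum a := Measure.sub_add_cancel_of_le hle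
  have hlim : ∀ f : S → ENNReal, (∀ x, f x ≤ 1) →
      Tendsto (fun n => ∫⁻ x, f x ∂(ν n)) atTop (𝓝 (∫⁻ x, f x ∂μ)) := by
    intro f hf
    have hft : ∀ ρ : Measure S, IsFiniteMeasure ρ → ∫⁻ x, f x ∂ρ ≠ ⊤ := fun ρ _ =>
      ne_top_of_le_ne_top (measure_ne_top ρ Set.univ)
        ((lintegral_mono hf).trans_eq (by simp))
    have hBt := hft (Measure.sum b) inferInstance
    have e1 : ∫⁻ x, f x ∂μ = (∫⁻ x, f x ∂(ν 0) + ∑' k, ∫⁻ x, f x ∂(a k))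
        - ∑' k, ∫⁻ x, f x ∂(b k) := by
      have := congrArg (fun m : Measure S => ∫⁻ x, f x ∂m) hadd
      simp only [lintegral_add_measure] at this
      rw [← lintegral_sum_measure, ← lintegral_sum_measure, ← this]
      exact (ENNReal.add_sub_cancel_right hBt).symm
    have e2 : ∀ n, ∫⁻ x, f x ∂(ν n) = (∫⁻ x, f x ∂(ν 0) + ∑ k ∈ Finset.range n, ∫⁻ x, f x ∂(a k))
        - ∑ k ∈ Finset.range n, ∫⁻ x, f x ∂(b k) := fun n => by
      rw [← hpart f n]
      refine (ENNReal.add_sub_cancel_right (ne_top_of_le_ne_top hBt ?_)).symm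
      rw [lintegral_sum_measure]
      exact ENNReal.sum_le_tsum _
    rw [e1]
    refine Tendsto.congr (fun n => (e2 n).symm) ?_
    refine ENNReal.Tendsto.sub (tendsto_const_nhds.add ENNReal.summable.hasSum.tendsto_sum_nat)
      ENNReal.summable.hasSum.tendsto_sum_nat (Or.inr ?_)
    rwa [← lintegral_sum_measure]
  refine ⟨μ, ⟨?_⟩, ?_, hlim⟩
  · have := hlim (fun _ => 1) fun _ => le_rfl
    simp only [lintegral_one, measure_univ] at this
    exact (tendsto_nhds_unique this tendsto_const_nhds)
  · refine ne_top_of_le_ne_top (ENNReal.add_ne_top.2 ⟨h0, hA⟩) ?_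
    rw [← lintegral_add_measure]
    exact lintegral_mono' Measure.sub_le le_rfl

lemma exists_invariant_of_contracts [Nonempty S] {P : Kernel S S} [IsMarkovKernel P] {V : S → ℝ}
    (hVm : Measurable V) (hV : ∀ x, 0 ≤ V x) {γ K : ℝ} (hP : LyapunovDrift P V γ K)
    {β α : ℝ} (hβ : 0 < β) (hα1 : α < 1) (hC : Contracts P V β α) :
    ∃ μ : Measure S, IsProbabilityMeasure μ ∧ Kernel.Invariant P μ ∧ Integrable V μ := by
  obtain ⟨x₀⟩ := ‹Nonempty S›
  have hw : Measurable fun x => ENNReal.ofReal (1 + β * V x) :=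
    ((hVm.const_mul β).const_add 1).ennreal_ofReal
  obtain ⟨ν, hν0, hν⟩ : ∃ ν : ℕ → Measure S, ν 0 = Measure.dirac x₀ ∧
      ∀ n, ν (n + 1) = P ∘ₘ ν n :=
    ⟨fun n => Nat.rec (Measure.dirac x₀) (fun _ μ => P ∘ₘ μ) n, rfl, fun _ => rfl⟩
  have hprob : ∀ n, IsProbabilityMeasure (ν n) := fun n => by
    induction n with
    | zero => rw [hν0]; infer_instance
    | succ n ih => rw [hν]; infer_instance
  have hν1 : ν 1 = P x₀ := by rw [hν 0, hν0, Measure.dirac_bind P.measurable x₀]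
  have h0 : ∫⁻ x, ENNReal.ofReal (1 + β * V x) ∂(ν 0) ≠ ⊤ := by
    rw [hν0, lintegral_dirac' _ hw]
    exact ENNReal.ofReal_ne_top
  have hd0 : weightedTV β V (ν 0) (ν 1) ≠ ⊤ := by
    refine ne_top_of_le_ne_top (ENNReal.add_ne_top.2 ⟨h0, ?_⟩)
      (weightedTV_le_lintegral_add β V (ν 0) (ν 1))
    rw [hν1]
    have hi : Integrable (fun x => 1 + β * V x) (P x₀) :=
      (integrable_const _).add ((hP x₀).1.const_mul β)
    exact hi.lintegral_lt_top.ne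
  have hstep : ∀ n, weightedTV β V (ν n) (ν (n + 1))
      ≤ ENNReal.ofReal α ^ n * weightedTV β V (ν 0) (ν 1) := fun n => by
    induction n with
    | zero => simp
    | succ n ih =>
      rw [weightedTV_congr (hν n) (hν (n + 1))]
      refine (hC (ν n) (ν (n + 1))).trans ?_
      rw [pow_succ', mul_assoc]
      gcongr
  have hsum : ∑' n, weightedTV β V (ν n) (ν (n + 1)) ≠ ⊤ := by
    refine ne_top_of_le_ne_top ?_ (ENNReal.tsum_le_tsum hstep)
    rw [ENNReal.tsum_mul_right, ENNReal.tsum_geometric]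
    refine ENNReal.mul_ne_top (ENNReal.inv_ne_top.2 ?_) hd0
    exact (tsub_pos_iff_lt.2 (by simpa using hα1)).ne'
  obtain ⟨μ, hμ, hfin, hlim⟩ :=
    exists_tendsto_lintegral_of_tsum_weightedTV_ne_top hβ.le hV ν h0 hsum
  refine ⟨μ, hμ, ?_, ?_⟩
  · refine Measure.ext fun s hs => ?_
    rw [Measure.bind_apply hs P.aemeasurable]
    have h1 := hlim (fun x => P x s) fun x => prob_le_one
    have h2 := (tendsto_add_atTop_iff_nat 1).2
      (hlim (s.indicator 1) fun x =>
        Set.indicator_le' (fun _ _ => le_rfl) (fun _ _ => zero_le_one) x)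
    simp only [lintegral_indicator_one hs] at h2
    refine tendsto_nhds_unique h1 (h2.congr fun n => ?_)
    rw [hν, Measure.bind_apply hs P.aemeasurable]
  · refine integrable_of_lintegral_weight_ne_top (L := β⁻¹) hVm (fun x => ?_) hfin
      (inv_nonneg.2 hβ.le)
    rw [abs_of_nonneg (hV x), mul_add, inv_mul_cancel_left₀ hβ.ne']
    have := inv_pos.2 hβ
    linarith

end Completeness

/-! ### Uniqueness of the invariant measure and the Poisson equation -/

section Poisson

open Filter Topology

variable {S : Type*} [MeasurableSpace S]

/-- The functions `Pⁿ f`, as iterated integrals. -/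
noncomputable def kernelIterate (P : Kernel S S) (f : S → ℝ) : ℕ → S → ℝ
  | 0 => f
  | n + 1 => fun x => ∫ y, kernelIterate P f n y ∂(P x)

lemma measurable_kernelIterate {P : Kernel S S} {f : S → ℝ} (hf : Measurable f) (n : ℕ) :
    Measurable (kernelIterate P f n) := by
  cases n with
  | zero => exact hf
  | succ n => exact (measurable_kernelIterate hf n).stronglyMeasurable.integral_kernel.measurable

/-- Functions of bounded oscillation relative to `1 + β V` are integrable wherever `V` is. -/
lemma integrable_of_forall_abs_sub_le [Nonempty S] {V h : S → ℝ} {β L : ℝ} (hh : Measurable h)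
    (hosc : ∀ x y, |h x - h y| ≤ L * (1 + β * V x) + L * (1 + β * V y))
    {ρ : Measure S} [IsFiniteMeasure ρ] (hρ : Integrable V ρ) : Integrable h ρ := by
  obtain ⟨c, hc⟩ := exists_abs_sub_le_of_forall_abs_sub_le hosc
  have hw : Integrable (fun x => L * (1 + β * V x)) ρ :=
    ((integrable_const _).add (hρ.const_mul β)).const_mul L
  have h1 : Integrable (fun x => h x - c) ρ :=
    hw.mono' (hh.sub_const c).aestronglyMeasurable (ae_of_all _ hc)
  exact (h1.add (integrable_const c)).congr (ae_of_all _ fun x => by simp)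

lemma integral_kernelIterate_of_invariant {P : Kernel S S} {f : S → ℝ} {μ : Measure S}
    (hμ : Kernel.Invariant P μ) (hi : ∀ n, Integrable (kernelIterate P f n) μ) (n : ℕ) :
    ∫ x, kernelIterate P f n x ∂μ = ∫ x, f x ∂μ := by
  induction n with
  | zero => rfl
  | succ n ih =>
    have h : Integrable (kernelIterate P f n) (P ∘ₘ μ) := by
      rw [hμ.def]
      exact hi n
    rw [← ih]
    change ∫ x, ∫ y, kernelIterate P f n y ∂(P x) ∂μ = _
    rw [← integral_kernel_comp_measure h, hμ.def]

variable [Nonempty S] {P : Kernel S S} [IsMarkovKernel P] {V : S → ℝ} {β α L : ℝ} {f : S → ℝ}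

lemma abs_kernelIterate_sub_le (hVm : Measurable V) (hV : ∀ x, 0 ≤ V x)
    (hPV : ∀ x, Integrable V (P x)) (hβ : 0 ≤ β) (hα : 0 ≤ α) (hP : Contracts P V β α) (hL : 0 ≤ L)
    (hf : Measurable f) (hosc : ∀ x y, |f x - f y| ≤ L * (1 + β * V x) + L * (1 + β * V y))
    (n : ℕ) (x y : S) :
    |kernelIterate P f n x - kernelIterate P f n y|
      ≤ α ^ n * L * (1 + β * V x) + α ^ n * L * (1 + β * V y) := by
  induction n generalizing x y with
  | zero => simpa [kernelIterate] using hosc x y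
  | succ n ih =>
    have := hP.abs_integral_sub_integral_le hVm hV hβ hα (mul_nonneg (pow_nonneg hα n) hL)
      (fun x => integrable_of_forall_abs_sub_le (measurable_kernelIterate hf n) ih (hPV x)) ih x y
    rw [pow_succ', mul_assoc α]
    exact this

/-- Geometric ergodicity in dual form: `Pⁿ f` converges to the constant `μ f`. -/
lemma abs_kernelIterate_sub_integral_le (hVm : Measurable V) (hV : ∀ x, 0 ≤ V x)
    (hPV : ∀ x, Integrable V (P x)) (hβ : 0 ≤ β) (hα : 0 ≤ α) (hP : Contracts P V β α) (hL : 0 ≤ L)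
    (hf : Measurable f) (hosc : ∀ x y, |f x - f y| ≤ L * (1 + β * V x) + L * (1 + β * V y))
    {μ : Measure S} [IsProbabilityMeasure μ] (hμ : Kernel.Invariant P μ) (hμV : Integrable V μ)
    (n : ℕ) (x : S) :
    |kernelIterate P f n x - ∫ y, f y ∂μ|
      ≤ α ^ n * (L * ((1 + β * V x) + ∫ y, (1 + β * V y) ∂μ)) := by
  have ho := abs_kernelIterate_sub_le hVm hV hPV hβ hα hP hL hf hosc
  have hi : ∀ n, Integrable (kernelIterate P f n) μ := fun n =>
    integrable_of_forall_abs_sub_le (measurable_kernelIterate hf n) (ho n) hμV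
  have hw : Integrable (fun y => 1 + β * V y) μ := (integrable_const _).add (hμV.const_mul β)
  rw [← integral_kernelIterate_of_invariant hμ hi n]
  have e : kernelIterate P f n x - ∫ y, kernelIterate P f n y ∂μ
      = ∫ y, (kernelIterate P f n x - kernelIterate P f n y) ∂μ := by
    rw [integral_sub (integrable_const _) (hi n)]
    simp
  rw [e]
  refine abs_integral_le_integral_abs.trans ((integral_mono
    ((integrable_const _).sub (hi n)).abs
    ((integrable_const _).add (hw.const_mul (α ^ n * L))) (ho n x)).trans_eq ?_)
  have e2 : ∫ y, (α ^ n * L * (1 + β * V x) + α ^ n * L * (1 + β * V y)) ∂μ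
      = α ^ n * L * (1 + β * V x) + α ^ n * L * ∫ y, (1 + β * V y) ∂μ := by
    rw [integral_add (integrable_const _) (hw.const_mul (α ^ n * L)),
      integral_const_mul (α ^ n * L) fun y => 1 + β * V y,
      integral_const, probReal_univ, one_smul]
  exact e2.trans (by ring)

/-- Uniqueness among all invariant probability measures, including those that might not
integrate `V`: the bounded functions `Pⁿ 1_A` converge pointwise to `μ A`, so every other invariant
probability measure gives `A` the same mass. -/
lemma eq_of_invariant_of_contracts (hVm : Measurable V) (hV : ∀ x, 0 ≤ V x)
    (hPV : ∀ x, Integrable V (P x)) (hβ : 0 ≤ β) (hα : 0 ≤ α) (hα1 : α < 1) (hP : Contracts P V β α)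
    {μ : Measure S} [IsProbabilityMeasure μ] (hμ : Kernel.Invariant P μ) (hμV : Integrable V μ)
    {ν : Measure S} [IsProbabilityMeasure ν] (hν : Kernel.Invariant P ν) : ν = μ := by
  refine Measure.ext fun s hs => ?_
  set f : S → ℝ := s.indicator fun _ => 1 with hfdef
  have hf : Measurable f := measurable_const.indicator hs
  have hf1 : ∀ x, |f x| ≤ 1 := fun x => by
    by_cases hx : x ∈ s <;> simp [hfdef, hx]
  have hF1 : ∀ n x, |kernelIterate P f n x| ≤ 1 := fun n => by
    induction n with
    | zero => exact hf1
    | succ n ih =>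
      intro x
      have := norm_integral_le_of_norm_le_const (μ := P x) (f := kernelIterate P f n) (C := 1)
        (ae_of_all _ ih)
      simpa [kernelIterate] using this
  have hosc : ∀ x y, |f x - f y| ≤ 1 * (1 + β * V x) + 1 * (1 + β * V y) := fun x y => by
    have h1 := mul_nonneg hβ (hV x)
    have h2 := mul_nonneg hβ (hV y)
    linarith [abs_sub (f x) (f y), hf1 x, hf1 y]
  have hi : ∀ n, Integrable (kernelIterate P f n) ν := fun n =>
    (integrable_const (1 : ℝ)).mono' (measurable_kernelIterate hf n).aestronglyMeasurable
      (ae_of_all _ (hF1 n))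
  have hlim : ∀ x, Tendsto (fun n => kernelIterate P f n x) atTop (𝓝 (∫ y, f y ∂μ)) := fun x => by
    refine tendsto_iff_norm_sub_tendsto_zero.2 ?_
    refine squeeze_zero (fun _ => norm_nonneg _) (fun n =>
      abs_kernelIterate_sub_integral_le hVm hV hPV hβ hα hP zero_le_one hf hosc hμ hμV n x) ?_
    simpa using (tendsto_pow_atTop_nhds_zero_of_lt_one hα hα1).mul_const _
  have hconv := tendsto_integral_of_dominated_convergence (μ := ν) (fun _ => (1 : ℝ))
    (fun n => (measurable_kernelIterate (P := P) hf n).aestronglyMeasurable) (integrable_const _)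
    (fun n => ae_of_all _ (hF1 n)) (ae_of_all _ hlim)
  simp_rw [integral_kernelIterate_of_invariant hν hi] at hconv
  have h := tendsto_nhds_unique hconv tendsto_const_nhds
  rw [integral_const, probReal_univ, one_smul, hfdef, integral_indicator_const _ hs,
    integral_indicator_const _ hs] at h
  simp only [smul_eq_mul, mul_one] at h
  exact ((measureReal_eq_measureReal_iff).1 h).symm

/-- The Poisson equation `ψ - P ψ = f - μ f`. The solution is the series `∑ (Pⁿ f - μ f)`, shifted
by a constant so that the bound on its oscillation becomes a bound on `ψ` itself. -/
lemma exists_poisson_solution (hVm : Measurable V) (hV : ∀ x, 0 ≤ V x)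
    (hPV : ∀ x, Integrable V (P x)) (hβ : 0 ≤ β) (hα : 0 ≤ α) (hα1 : α < 1) (hP : Contracts P V β α)
    (hL : 0 ≤ L) (hf : Measurable f) (hfL : ∀ x, |f x| ≤ L * (1 + β * V x))
    {μ : Measure S} [IsProbabilityMeasure μ] (hμ : Kernel.Invariant P μ) (hμV : Integrable V μ) :
    ∃ ψ : S → ℝ, Measurable ψ ∧ (∀ x, |ψ x| ≤ L / (1 - α) * (1 + β * V x)) ∧
      ∀ x, ψ x - ∫ y, ψ y ∂(P x) = f x - ∫ y, f y ∂μ := by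
  have hosc : ∀ x y, |f x - f y| ≤ L * (1 + β * V x) + L * (1 + β * V y) := fun x y =>
    (abs_sub _ _).trans (add_le_add (hfL x) (hfL y))
  have ho := abs_kernelIterate_sub_le hVm hV hPV hβ hα hP hL hf hosc
  have hb := abs_kernelIterate_sub_integral_le hVm hV hPV hβ hα hP hL hf hosc hμ hμV
  set m := ∫ y, f y ∂μ with hm
  set W := ∫ y, (1 + β * V y) ∂μ with hW
  have hgeo : ∀ c : ℝ, Summable fun n : ℕ => α ^ n * c := fun c =>
    (summable_geometric_of_lt_one hα hα1).mul_right c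
  have hs : ∀ x, Summable fun n => kernelIterate P f n x - m := fun x =>
    (hgeo _).of_norm_bounded (hb · x)
  set u : S → ℝ := fun x => ∑' n, (kernelIterate P f n x - m) with hu
  have hum : Measurable u :=
    measurable_of_tendsto_metrizable
      (fun n => Finset.measurable_sum (Finset.range n)
        fun k _ => (measurable_kernelIterate (P := P) hf k).sub_const m)
      (tendsto_pi_nhds.2 fun x => by
        simpa [Finset.sum_apply] using (hs x).hasSum.tendsto_sum_nat)
  have huosc : ∀ x y, |u x - u y| ≤ L / (1 - α) * (1 + β * V x) + L / (1 - α) * (1 + β * V y) := by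
    intro x y
    have h1 : u x - u y = ∑' n, (kernelIterate P f n x - kernelIterate P f n y) := by
      rw [hu]
      simp only
      rw [← (hs x).tsum_sub (hs y)]
      simp
    rw [h1]
    have h2 := tsum_of_norm_bounded (f := fun n => kernelIterate P f n x - kernelIterate P f n y)
      (((hasSum_geometric_of_lt_one hα hα1).mul_right
        (L * (1 + β * V x) + L * (1 + β * V y))))
      (fun n => (ho n x y).trans_eq (by rw [mul_assoc, mul_assoc, ← mul_add]))
    refine h2.trans_eq ?_
    ring
  have hFi : ∀ n x, Integrable (kernelIterate P f n) (P x) := fun n x =>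
    integrable_of_forall_abs_sub_le (measurable_kernelIterate hf n) (ho n) (hPV x)
  have hui : ∀ x, Integrable u (P x) := fun x =>
    integrable_of_forall_abs_sub_le hum huosc (hPV x)
  have hpoisson : ∀ x, u x - ∫ y, u y ∂(P x) = f x - m := by
    intro x
    have hbi : Integrable (fun y => L * ((1 + β * V y) + W)) (P x) :=
      (((integrable_const _).add ((hPV x).const_mul β)).add (integrable_const _)).const_mul L
    have h1 : ∑' n, ∫ y, (kernelIterate P f n y - m) ∂(P x) = ∫ y, u y ∂(P x) := by
      refine integral_tsum_of_summable_integral_norm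
        (fun n => (hFi n x).sub (integrable_const m)) ?_
      refine (hgeo (∫ y, L * ((1 + β * V y) + W) ∂(P x))).of_nonneg_of_le
        (fun n => integral_nonneg fun _ => norm_nonneg _) fun n => ?_
      rw [← integral_const_mul]
      exact integral_mono ((hFi n x).sub (integrable_const m)).norm (hbi.const_mul _) (hb n)
    have h2 : ∀ n, ∫ y, (kernelIterate P f n y - m) ∂(P x) = kernelIterate P f (n + 1) x - m :=
      fun n => by
        rw [integral_sub (hFi n x) (integrable_const m)]
        simp [kernelIterate]
    rw [← h1]
    simp_rw [h2]
    rw [hu]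
    simp only
    rw [(hs x).tsum_eq_zero_add]
    simp [kernelIterate]
  obtain ⟨c, hc⟩ := exists_abs_sub_le_of_forall_abs_sub_le huosc
  refine ⟨fun x => u x - c, hum.sub_const c, hc, fun x => ?_⟩
  rw [integral_sub (hui x) (integrable_const c), ← hpoisson x]
  simp

end Poisson


/-! ### Moments along a Markov chain -/

section MarkovChain

variable {S Ω : Type*} [MeasurableSpace S] [MeasurableSpace Ω] {Pr : Measure Ω}
  {Q : Kernel S S} {x₀ : S} {X : ℕ → Ω → S}

lemma IsMarkovChainFrom.aemeasurable (hX : IsMarkovChainFrom Pr Q x₀ X) (k : ℕ) :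
    AEMeasurable (X k) Pr := by
  cases k with
  | zero => exact hX.init.aemeasurable
  | succ k => exact (hX.step k).aemeasurable_snd

variable [IsProbabilityMeasure Pr] [IsMarkovKernel Q]

lemma IsMarkovChainFrom.map_succ (hX : IsMarkovChainFrom Pr Q x₀ X) (k : ℕ) :
    Pr.map (X (k + 1)) = Q ∘ₘ Pr.map (X k) := by
  have h : HasCondDistrib (X (k + 1)) (X k) Q Pr := (hX.step k).comp_right
  rw [← Measure.snd_compProd, ← h.map_eq, Measure.snd_map_prodMk₀ (hX.aemeasurable k)]

/-- The Markov property against test functions of the whole past. -/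
lemma IsMarkovChainFrom.integral_mul_next (hX : IsMarkovChainFrom Pr Q x₀ X) (k : ℕ)
    {G : (Fin (k + 1) → S) → ℝ} {f : S → ℝ} (hG : Measurable G) (hf : Measurable f)
    (hi : Integrable (fun ω => G (fun i => X i ω) * f (X (k + 1) ω)) Pr) :
    ∫ ω, G (fun i => X i ω) * f (X (k + 1) ω) ∂Pr
      = ∫ ω, G (fun i => X i ω) * ∫ y, f y ∂(Q (X k ω)) ∂Pr := by
  have hp := hX.step k
  have hh : AEMeasurable (fun ω (i : Fin (k + 1)) => X i ω) Pr := hp.aemeasurable_fst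
  have hF : Measurable fun p : (Fin (k + 1) → S) × S => G p.1 * f p.2 :=
    (hG.comp measurable_fst).mul (hf.comp measurable_snd)
  have hi' : Integrable (fun p : (Fin (k + 1) → S) × S => G p.1 * f p.2)
      (Pr.map fun ω => ((fun i : Fin (k + 1) => X i ω), X (k + 1) ω)) :=
    (integrable_map_measure hF.aestronglyMeasurable hp.aemeasurable).2 hi
  have e1 : ∫ p, G p.1 * f p.2 ∂(Pr.map fun ω => ((fun i : Fin (k + 1) => X i ω), X (k + 1) ω))
      = ∫ ω, G (fun i => X i ω) * f (X (k + 1) ω) ∂Pr :=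
    integral_map hp.aemeasurable hF.aestronglyMeasurable
  rw [hp.map_eq] at hi' e1
  rw [← e1, Measure.integral_compProd hi']
  simp only [integral_const_mul, Kernel.comap_apply]
  have hm : Measurable fun h : Fin (k + 1) → S => G h * ∫ y, f y ∂(Q (h (Fin.last k))) :=
    hG.mul (hf.stronglyMeasurable.integral_kernel.measurable.comp (measurable_pi_apply _))
  rw [integral_map hh hm.aestronglyMeasurable]
  simp

/-- The martingale part of `∑ f(Xₖ₊₁)` has second moment at most `∑ E f(Xₖ₊₁)²`. -/
lemma IsMarkovChainFrom.integral_sq_sum_sub_le (hX : IsMarkovChainFrom Pr Q x₀ X)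
    {f : S → ℝ} (hf : Measurable f) (hf2 : ∀ k, MemLp (fun ω => f (X k ω)) 2 Pr)
    (hQf2 : ∀ k, MemLp (fun ω => ∫ y, f y ∂(Q (X k ω))) 2 Pr) (n : ℕ) :
    ∫ ω, (∑ k ∈ Finset.range n, (f (X (k + 1) ω) - ∫ y, f y ∂(Q (X k ω)))) ^ 2 ∂Pr
      ≤ ∑ k ∈ Finset.range n, ∫ ω, f (X (k + 1) ω) ^ 2 ∂Pr := by
  have hM : ∀ n, MemLp (fun ω => ∑ k ∈ Finset.range n,
      (f (X (k + 1) ω) - ∫ y, f y ∂(Q (X k ω)))) 2 Pr := fun n =>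
    memLp_finsetSum _ fun k _ => (hf2 (k + 1)).sub (hQf2 k)
  have hQm : Measurable fun x => ∫ y, f y ∂(Q x) :=
    hf.stronglyMeasurable.integral_kernel.measurable
  induction n with
  | zero => simp
  | succ n ih =>
    -- With `q = (Q f)(Xₙ)` and `M` the sum so far, `M - q` depends on the past only, so that
    -- `E (M - q + f(Xₙ₊₁))² = E M² - E q² + E f(Xₙ₊₁)²`.
    let G : (Fin (n + 1) → S) → ℝ := fun h =>
      ∑ k : Fin n, (f (h k.succ) - ∫ y, f y ∂(Q (h k.castSucc))) - ∫ y, f y ∂(Q (h (Fin.last n)))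
    have hGm : Measurable G := by
      refine Measurable.sub (Finset.measurable_sum _ fun k _ => ?_)
        (hQm.comp (measurable_pi_apply _))
      exact (hf.comp (measurable_pi_apply _)).sub (hQm.comp (measurable_pi_apply _))
    have hG : ∀ ω, G (fun i => X i ω) = (∑ k ∈ Finset.range n,
        (f (X (k + 1) ω) - ∫ y, f y ∂(Q (X k ω)))) - ∫ y, f y ∂(Q (X n ω)) := fun ω => by
      simp only [G, Finset.sum_range, Fin.val_succ, Fin.val_castSucc, Fin.val_last]
    have hGL : MemLp (fun ω => G (fun i => X i ω)) 2 Pr := by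
      simp_rw [hG]
      exact (hM n).sub (hQf2 n)
    have h1 := hX.integral_mul_next n hGm hf (hGL.integrable_mul (hf2 (n + 1)))
    have i1 : Integrable (fun ω => G (fun i => X i ω) ^ 2) Pr := hGL.integrable_sq
    have i2 : Integrable (fun ω => G (fun i => X i ω) * f (X (n + 1) ω)) Pr :=
      hGL.integrable_mul (hf2 (n + 1))
    have i3 : Integrable (fun ω => f (X (n + 1) ω) ^ 2) Pr := (hf2 (n + 1)).integrable_sq
    have i4 : Integrable (fun ω => G (fun i => X i ω) * ∫ y, f y ∂(Q (X n ω))) Pr :=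
      hGL.integrable_mul (hQf2 n)
    have i5 : Integrable (fun ω => (∑ k ∈ Finset.range n,
      (f (X (k + 1) ω) - ∫ y, f y ∂(Q (X k ω)))) ^ 2) Pr := (hM n).integrable_sq
    have e1 : ∫ ω, (∑ k ∈ Finset.range (n + 1), (f (X (k + 1) ω) - ∫ y, f y ∂(Q (X k ω)))) ^ 2 ∂Pr
        = ∫ ω, G (fun i => X i ω) ^ 2 ∂Pr + 2 * ∫ ω, G (fun i => X i ω) * f (X (n + 1) ω) ∂Pr
          + ∫ ω, f (X (n + 1) ω) ^ 2 ∂Pr := by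
      have i12 : Integrable (fun ω => G (fun i => X i ω) ^ 2
          + 2 * (G (fun i => X i ω) * f (X (n + 1) ω))) Pr := i1.add (i2.const_mul 2)
      rw [← integral_const_mul, ← integral_add i1 (i2.const_mul 2), ← integral_add i12 i3]
      refine integral_congr_ae (ae_of_all _ fun ω => ?_)
      simp only
      rw [Finset.sum_range_succ, hG ω]
      ring
    have e2 : ∫ ω, G (fun i => X i ω) ^ 2 ∂Pr
        + 2 * ∫ ω, G (fun i => X i ω) * ∫ y, f y ∂(Q (X n ω)) ∂Pr
        ≤ ∫ ω, (∑ k ∈ Finset.range n, (f (X (k + 1) ω) - ∫ y, f y ∂(Q (X k ω)))) ^ 2 ∂Pr := by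
      rw [← integral_const_mul, ← integral_add i1 (i4.const_mul 2)]
      refine integral_mono (i1.add (i4.const_mul 2)) i5 fun ω => ?_
      simp only [hG ω]
      nlinarith [sq_nonneg (∫ y, f y ∂(Q (X n ω)))]
    rw [Finset.sum_range_succ, e1, h1]
    linarith

lemma IsMarkovChainFrom.integrable_and_integral_le (hX : IsMarkovChainFrom Pr Q x₀ X)
    {V : S → ℝ} (hVm : Measurable V) (hV : ∀ x, 0 ≤ V x) {γ K : ℝ} (hγ0 : 0 ≤ γ) (hγ1 : γ < 1)
    (hK : 0 ≤ K) (hQ : LyapunovDrift Q V γ K) (k : ℕ) :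
    Integrable (fun ω => V (X k ω)) Pr ∧
      ∫ ω, V (X k ω) ∂Pr ≤ γ ^ k * V x₀ + K / (1 - γ) := by
  have hg : 0 < 1 - γ := by linarith
  have key : Integrable V (Pr.map (X k)) ∧
      ∫ x, V x ∂(Pr.map (X k)) ≤ γ ^ k * V x₀ + K / (1 - γ) := by
    induction k with
    | zero =>
      rw [hX.init.map_eq, integral_dirac' _ _ hVm.stronglyMeasurable]
      refine ⟨integrable_dirac' hVm.stronglyMeasurable (by simp), ?_⟩
      have : 0 ≤ K / (1 - γ) := by positivity
      simpa using this
    | succ k ih =>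
      have : IsProbabilityMeasure (Pr.map (X k)) :=
        Measure.isProbabilityMeasure_map (hX.aemeasurable k)
      have hi := hQ.integrable_comp hVm hV ih.1
      rw [hX.map_succ k]
      refine ⟨hi, ?_⟩
      rw [integral_kernel_comp_measure hi]
      have hb : Integrable (fun x => γ * V x + K) (Pr.map (X k)) :=
        (ih.1.const_mul γ).add (integrable_const K)
      have hm := ((Measure.integrable_comp_iff hVm.aestronglyMeasurable).1 hi).2
      simp only [Real.norm_of_nonneg (hV _)] at hm
      refine (integral_mono hm hb fun x => (hQ x).2).trans ?_
      rw [integral_add (ih.1.const_mul γ) (integrable_const K), integral_const_mul, integral_const,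
        probReal_univ, one_smul]
      have e : γ * (K / (1 - γ)) + K = K / (1 - γ) := by field_simp; ring
      have := mul_le_mul_of_nonneg_left ih.2 hγ0
      rw [pow_succ']
      linarith
  refine ⟨(integrable_map_measure hVm.aestronglyMeasurable (hX.aemeasurable k)).1 key.1, ?_⟩
  rw [← integral_map (hX.aemeasurable k) hVm.aestronglyMeasurable]
  exact key.2

end MarkovChain

/-! ### Comparison of the `√V`- and `V`-weighted distances -/

section Perturbation

variable {S : Type*} [MeasurableSpace S]

/-- The `√V`-weighted distance is controlled by the square root of the `V`-weighted one. This is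
the Cauchy-Schwarz inequality against `|μ - ν|`, whose total mass is at most `2`, in the form
`1 + √V ≤ c + (1 + V) / (2 c)` with `c = √t / 2`. -/
lemma weightedTV_sqrt_le {V : S → ℝ} (hV : ∀ x, 0 ≤ V x) {μ ν : Measure S}
    [IsProbabilityMeasure μ] [IsProbabilityMeasure ν] {t : ℝ} (ht : 0 ≤ t)
    (h : weightedTV 1 V μ ν ≤ ENNReal.ofReal t) :
    weightedTV 1 (fun x => √(V x)) μ ν ≤ ENNReal.ofReal (2 * √t) := by
  have hsq : ∀ x, √(V x) ^ 2 = V x := fun x => Real.sq_sqrt (hV x)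
  rcases ht.eq_or_lt with rfl | ht
  · have h0 : weightedTV 1 V μ ν = 0 := by simpa using h
    have : weightedTV 1 (fun x => √(V x)) μ ν ≤ ENNReal.ofReal 2 * weightedTV 1 V μ ν := by
      rw [weightedTV, weightedTV, ← lintegral_const_mul' _ _ ENNReal.ofReal_ne_top]
      refine lintegral_mono fun x => ?_
      rw [← ENNReal.ofReal_mul zero_le_two]
      refine ENNReal.ofReal_le_ofReal ?_
      nlinarith [hsq x, sq_nonneg (√(V x) - 1), hV x]
    rw [h0, mul_zero] at this
    exact this.trans zero_le
  · set c : ℝ := √t / 2 with hc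
    have hst : 0 < √t := Real.sqrt_pos.2 ht
    have hc0 : 0 < c := by positivity
    have hd0 : 0 < 1 / (2 * c) := by positivity
    have hmass : (μ.toSignedMeasure - ν.toSignedMeasure).totalVariation Set.univ
        ≤ ENNReal.ofReal 2 := by
      have := weightedTV_le_lintegral_add 0 V μ ν
      rw [weightedTV] at this
      simp only [zero_mul, add_zero, ENNReal.ofReal_one, lintegral_one, measure_univ] at this
      refine this.trans (le_of_eq ?_)
      rw [one_add_one_eq_two]
      simp
    have hpt : ∀ x, 1 + 1 * √(V x) ≤ c + 1 / (2 * c) * (1 + 1 * V x) := fun x => by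
      have h1 : c + 1 / (2 * c) * (1 + 1 * V x) - (1 + 1 * √(V x))
          = ((2 * c - (1 + √(V x))) ^ 2 + (1 - √(V x)) ^ 2) / (4 * c) := by
        rw [← hsq x]
        simp only [Real.sqrt_sq (Real.sqrt_nonneg _)]
        field_simp
        ring
      have h2 : 0 ≤ ((2 * c - (1 + √(V x))) ^ 2 + (1 - √(V x)) ^ 2) / (4 * c) := by positivity
      linarith
    calc weightedTV 1 (fun x => √(V x)) μ ν
        ≤ ∫⁻ x, (ENNReal.ofReal c + ENNReal.ofReal (1 / (2 * c)) * ENNReal.ofReal (1 + 1 * V x))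
            ∂(μ.toSignedMeasure - ν.toSignedMeasure).totalVariation := by
          refine lintegral_mono fun x => ?_
          rw [← ENNReal.ofReal_mul hd0.le, ← ENNReal.ofReal_add hc0.le
            (mul_nonneg hd0.le (by linarith [hV x]))]
          exact ENNReal.ofReal_le_ofReal (hpt x)
      _ = ENNReal.ofReal c * (μ.toSignedMeasure - ν.toSignedMeasure).totalVariation Set.univ
            + ENNReal.ofReal (1 / (2 * c)) * weightedTV 1 V μ ν := by
          rw [lintegral_add_left measurable_const, lintegral_const,
            lintegral_const_mul' _ _ ENNReal.ofReal_ne_top, weightedTV]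
      _ ≤ ENNReal.ofReal c * ENNReal.ofReal 2
            + ENNReal.ofReal (1 / (2 * c)) * ENNReal.ofReal t := by gcongr
      _ = ENNReal.ofReal (2 * √t) := by
          rw [← ENNReal.ofReal_mul hc0.le, ← ENNReal.ofReal_mul hd0.le,
            ← ENNReal.ofReal_add (by positivity) (by positivity)]
          congr 1
          rw [hc]
          have : t = √t ^ 2 := (Real.sq_sqrt ht.le).symm
          field_simp
          linarith

end Perturbation


/-! ### The mean-square error bound -/

section MeanSquareError

variable {S : Type u} [MeasurableSpace S]

/-- The decomposition of the centred sums into a boundary term, a martingale, and the accumulated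
defect of the Poisson solution `ψ` of `P` under the kernel `Q` of the chain. -/
lemma sum_range_sub_eq_of_poisson {Ω : Type*} {P Q : Kernel S S} {φ ψ : S → ℝ} {m : ℝ}
    (hsol : ∀ x, ψ x - ∫ y, ψ y ∂(P x) = φ x - m) (X : ℕ → Ω → S) (ω : Ω) (n : ℕ) :
    ∑ k ∈ Finset.range n, (φ (X k ω) - m) = (ψ (X 0 ω) - ψ (X n ω))
      + ∑ k ∈ Finset.range n, (ψ (X (k + 1) ω) - ∫ y, ψ y ∂(Q (X k ω)))
      + ∑ k ∈ Finset.range n, (∫ y, ψ y ∂(Q (X k ω)) - ∫ y, ψ y ∂(P (X k ω))) := by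
  induction n with
  | zero => simp
  | succ n ih =>
    simp only [Finset.sum_range_succ, ih]
    linarith [hsol (X n ω)]

lemma sum_range_pow_mul_add_le {r a b : ℝ} (hr0 : 0 ≤ r) (hr1 : r < 1) (ha : 0 ≤ a) (n : ℕ) :
    ∑ k ∈ Finset.range n, (r ^ k * a + b) ≤ a / (1 - r) + n * b := by
  rw [Finset.sum_add_distrib, ← Finset.sum_mul, Finset.sum_const, Finset.card_range, nsmul_eq_mul]
  have h := (summable_geometric_of_lt_one hr0 hr1).sum_le_tsum (Finset.range n)
    fun k _ => pow_nonneg hr0 k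
  rw [tsum_geometric_of_lt_one hr0 hr1] at h
  have h2 := mul_le_mul_of_nonneg_right h ha
  rw [inv_mul_eq_div] at h2
  linarith

/-- The defect `(Q - P) ψ` of the Poisson solution under the perturbed kernel. -/
lemma sq_integral_sub_integral_le_of_weightedClose {P Q : Kernel S S} [IsMarkovKernel P]
    [IsMarkovKernel Q] {V : S → ℝ} (hVm : Measurable V) (hV : ∀ x, 0 ≤ V x)
    {ε δ A : ℝ} (hε : 0 ≤ ε) (hδ : 0 ≤ δ) (hA : 0 ≤ A) (hPQ : WeightedClose P Q V ε δ)
    {ψ : S → ℝ} (hψA : ∀ x, |ψ x| ≤ A * (1 + √(V x)))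
    (hiP : ∀ x, Integrable ψ (P x)) (hiQ : ∀ x, Integrable ψ (Q x)) (x : S) :
    (∫ y, ψ y ∂(Q x) - ∫ y, ψ y ∂(P x)) ^ 2 ≤ 4 * A ^ 2 * ε * (1 + δ * V x) := by
  have ht : 0 ≤ ε * (1 + δ * V x) :=
    mul_nonneg hε (by have := mul_nonneg hδ (hV x); linarith)
  have h := abs_integral_sub_integral_le (β := 1) (L := A) (h := ψ)
    (fun x => Real.sqrt_nonneg (V x)) hVm.sqrt zero_le_one
    hA (by positivity) (by simpa using hψA) (hiP x) (hiQ x) (weightedTV_sqrt_le hV ht (hPQ x))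
  rw [abs_sub_comm] at h
  have h2 := pow_le_pow_left₀ (abs_nonneg _) h 2
  rw [sq_abs] at h2
  refine h2.trans_eq ?_
  rw [mul_pow, mul_pow, Real.sq_sqrt ht]
  ring

/-- The constant `c₀ = 1 + δ Kε / (1 - γε)` produced by the proof is within the required bound. -/
lemma one_add_mul_div_le {δ γ K : ℝ} (hδ : 0 ≤ δ) (hγ0 : 0 < γ) (hγ1 : γ < 1) (hK : 0 < K) :
    1 + δ * (K / (1 - γ)) ≤ 2 + 5 * (max δ √δ * max K √K) / (1 - √γ) ^ 2 := by
  have hs1 : √γ < 1 := by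
    rw [Real.sqrt_lt' one_pos]
    linarith
  have hs0 : 0 < √γ := Real.sqrt_pos.2 hγ0
  have hsq : √γ ^ 2 = γ := Real.sq_sqrt hγ0.le
  have h1 : δ * K ≤ max δ √δ * max K √K :=
    mul_le_mul (le_max_left _ _) (le_max_left _ _) hK.le (hδ.trans (le_max_left _ _))
  have h2 : (1 - √γ) ^ 2 ≤ 1 - γ := by nlinarith
  have h3 : δ * (K / (1 - γ)) ≤ (max δ √δ * max K √K) / (1 - √γ) ^ 2 := by
    rw [← mul_div_assoc]
    exact div_le_div₀ ((mul_nonneg hδ hK.le).trans h1) h1 (pow_pos (by linarith) 2) h2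
  have h4 : 0 ≤ (max δ √δ * max K √K) / (1 - √γ) ^ 2 :=
    (mul_nonneg hδ (div_nonneg hK.le (by linarith))).trans h3
  rw [mul_div_assoc]
  linarith

/-- The mean-square error bound follows from solvability of the Poisson equation with solutions
bounded by `A (1 + √V)`. -/
lemma meanSquareErrorBound_of_poisson {P : Kernel S S} [IsMarkovKernel P] {V : S → ℝ}
    (hVm : Measurable V) (hV : ∀ x, 0 ≤ V x) (hPV : ∀ x, Integrable V (P x)) {μ₀ : Measure S}
    {A : ℝ} (hA : 0 ≤ A)
    (hsol : ∀ φ : S → ℝ, Measurable φ → (∀ x, |φ x| ≤ √(V x)) →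
      ∃ ψ : S → ℝ, Measurable ψ ∧ (∀ x, |ψ x| ≤ A * (1 + √(V x))) ∧
        ∀ x, ψ x - ∫ y, ψ y ∂(P x) = φ x - ∫ y, φ y ∂μ₀) :
    MeanSquareErrorBound.{u, w} P V μ₀ (2 * A) := by
  -- The first summand bounds `(ψ(X₀) - ψ(Xₙ))²`, the second the effect of `V x₀` on the
  -- variances of the martingale increments.
  refine ⟨fun γ K v => 3 * (8 * A ^ 2 * (1 + v + K / (1 - γ)) + 2 * A ^ 2 * (v / (1 - γ))), ?_⟩
  intro δ γ K hδ hγ0 hγ1 hK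
  refine ⟨1 + δ * (K / (1 - γ)), 2 + √K / (1 - √γ), one_add_mul_div_le hδ hγ0 hγ1 hK, rfl, ?_⟩
  intro ε Q _ hε hPQ hQ Ω _ Pr _ x₀ X hX φ hφm hφV n hn
  obtain ⟨ψ, hψm, hψA, hψ⟩ := hsol φ hφm hφV
  have hg : 0 < 1 - γ := by linarith
  have hn0 : (0 : ℝ) < n := by exact_mod_cast hn
  have hv := hV x₀
  have hVX := hX.integrable_and_integral_le hVm hV hγ0.le hγ1 hK.le hQ
  set v := V x₀ with hvdef
  set W := K / (1 - γ) with hW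
  have hW0 : 0 ≤ W := by positivity
  have hψsq : ∀ x, ψ x ^ 2 ≤ 2 * A ^ 2 * (1 + V x) := fun x => by
    have h1 := pow_le_pow_left₀ (abs_nonneg _) (hψA x) 2
    rw [sq_abs, mul_pow] at h1
    have h2 : (1 + √(V x)) ^ 2 ≤ 2 * (1 + V x) := by
      nlinarith [Real.sq_sqrt (hV x), sq_nonneg (1 - √(V x))]
    have h3 := mul_le_mul_of_nonneg_left h2 (sq_nonneg A)
    linarith
  have hψi : ∀ ρ : Measure S, IsFiniteMeasure ρ → Integrable V ρ → Integrable ψ ρ := fun ρ _ hρ =>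
    (((integrable_const 1).add (integrable_sqrt_of_integrable hVm hV hρ)).const_mul A).mono'
      hψm.aestronglyMeasurable (ae_of_all _ hψA)
  have hiP : ∀ x, Integrable ψ (P x) := fun x => hψi _ inferInstance (hPV x)
  have hiQ : ∀ x, Integrable ψ (Q x) := fun x => hψi _ inferInstance (hQ x).1
  have hdefect := sq_integral_sub_integral_le_of_weightedClose hVm hV hε hδ hA hPQ hψA hiP hiQ
  set q : S → ℝ := fun x => ∫ y, ψ y ∂(Q x) with hqdef
  set p : S → ℝ := fun x => ∫ y, ψ y ∂(P x) with hpdef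
  have hqm : Measurable q := hψm.stronglyMeasurable.integral_kernel.measurable
  have hpm : Measurable p := hψm.stronglyMeasurable.integral_kernel.measurable
  have hV1 : ∀ k, Integrable (fun ω => 1 + V (X k ω)) Pr := fun k =>
    (integrable_const 1).add (hVX k).1
  have hVδ : ∀ k, Integrable (fun ω => 1 + δ * V (X k ω)) Pr := fun k =>
    (integrable_const 1).add ((hVX k).1.const_mul δ)
  have hL2 : ∀ (f : S → ℝ) (c : ℝ), Measurable f → (∀ x, f x ^ 2 ≤ c * (1 + V x)) → ∀ k,
      MemLp (fun ω => f (X k ω)) 2 Pr := by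
    intro f c hf hfc k
    have hfm : AEStronglyMeasurable (fun ω => f (X k ω)) Pr :=
      (hf.comp_aemeasurable (hX.aemeasurable k)).aestronglyMeasurable
    rw [memLp_two_iff_integrable_sq hfm]
    refine ((hV1 k).const_mul c).mono' (hfm.pow 2) (ae_of_all _ fun ω => ?_)
    rw [Real.norm_of_nonneg (sq_nonneg _)]
    exact hfc _
  have hψL := hL2 ψ (2 * A ^ 2) hψm hψsq
  have hdL : ∀ k, MemLp (fun ω => q (X k ω) - p (X k ω)) 2 Pr :=
    hL2 (fun x => q x - p x) (4 * A ^ 2 * ε * (1 + δ)) (hqm.sub hpm) fun x => by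
      refine (hdefect x).trans ?_
      rw [mul_assoc (4 * A ^ 2 * ε) (1 + δ)]
      refine mul_le_mul_of_nonneg_left ?_ (by positivity)
      nlinarith [hV x]
  -- `Q ψ = ψ - φ + μ₀ φ + (Q - P) ψ` is a sum of square-integrable functions.
  have hφL : ∀ k, MemLp (fun ω => φ (X k ω)) 2 Pr :=
    hL2 φ 1 hφm fun x => by
      have h1 := pow_le_pow_left₀ (abs_nonneg _) (hφV x) 2
      rw [sq_abs, Real.sq_sqrt (hV x)] at h1
      linarith
  set m := ∫ y, φ y ∂μ₀ with hm
  have hqL : ∀ k, MemLp (fun ω => q (X k ω)) 2 Pr := fun k => by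
    have h := (((hψL k).sub (hφL k)).add (memLp_const m)).add (hdL k)
    refine h.ae_eq (ae_of_all _ fun ω => ?_)
    have := hψ (X k ω)
    simp only [Pi.add_apply, Pi.sub_apply, hpdef]
    linarith
  have hEψ : ∀ k, ∫ ω, ψ (X k ω) ^ 2 ∂Pr ≤ 2 * A ^ 2 * (1 + (γ ^ k * v + W)) := fun k => by
    refine (integral_mono (hψL k).integrable_sq ((hV1 k).const_mul _) fun ω => hψsq _).trans ?_
    rw [integral_const_mul, integral_add (integrable_const 1) (hVX k).1, integral_const,
      probReal_univ, one_smul]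
    exact mul_le_mul_of_nonneg_left (by linarith [(hVX k).2]) (by positivity)
  have hEd : ∀ k, ∫ ω, (q (X k ω) - p (X k ω)) ^ 2 ∂Pr
      ≤ 4 * A ^ 2 * ε * (1 + δ * (γ ^ k * v + W)) := fun k => by
    refine (integral_mono (hdL k).integrable_sq ((hVδ k).const_mul _) fun ω => hdefect _).trans ?_
    rw [integral_const_mul, integral_add (integrable_const 1) ((hVX k).1.const_mul δ),
      integral_const, probReal_univ, one_smul, integral_const_mul]
    refine mul_le_mul_of_nonneg_left ?_ (by positivity)
    linarith [mul_le_mul_of_nonneg_left (hVX k).2 hδ]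
  set B : Ω → ℝ := fun ω => ψ (X 0 ω) - ψ (X n ω) with hB
  set M : Ω → ℝ := fun ω => ∑ k ∈ Finset.range n, (ψ (X (k + 1) ω) - q (X k ω)) with hM
  set E : Ω → ℝ := fun ω => ∑ k ∈ Finset.range n, (q (X k ω) - p (X k ω)) with hE
  have hBL : MemLp B 2 Pr := (hψL 0).sub (hψL n)
  have hML : MemLp M 2 Pr := memLp_finsetSum _ fun k _ => (hψL (k + 1)).sub (hqL k)
  have hEL : MemLp E 2 Pr := memLp_finsetSum _ fun k _ => hdL k
  have hdec : ∀ ω, (1 / (n : ℝ)) * ∑ k ∈ Finset.range n, φ (X k ω) - m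
      = (1 / (n : ℝ)) * (B ω + M ω + E ω) := fun ω => by
    rw [← sum_range_sub_eq_of_poisson hψ X ω n, Finset.sum_sub_distrib, Finset.sum_const,
      Finset.card_range, nsmul_eq_mul]
    field_simp
  have hγpow : ∀ k, γ ^ k ≤ 1 := fun k => pow_le_one₀ hγ0.le hγ1.le
  have hEB : ∫ ω, B ω ^ 2 ∂Pr ≤ 8 * A ^ 2 * (1 + v + W) := by
    have h1 : ∫ ω, B ω ^ 2 ∂Pr ≤ ∫ ω, (2 * ψ (X 0 ω) ^ 2 + 2 * ψ (X n ω) ^ 2) ∂Pr :=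
      integral_mono hBL.integrable_sq
        (((hψL 0).integrable_sq.const_mul 2).add ((hψL n).integrable_sq.const_mul 2)) fun ω => by
          simp only [hB]
          nlinarith [sq_nonneg (ψ (X 0 ω) + ψ (X n ω))]
    rw [integral_add ((hψL 0).integrable_sq.const_mul 2) ((hψL n).integrable_sq.const_mul 2),
      integral_const_mul, integral_const_mul] at h1
    have h2 : ∀ k, ∫ ω, ψ (X k ω) ^ 2 ∂Pr ≤ 2 * A ^ 2 * (1 + v + W) := fun k => by
      refine (hEψ k).trans (mul_le_mul_of_nonneg_left ?_ (by positivity))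
      linarith [mul_le_mul_of_nonneg_right (hγpow k) hv]
    linarith [h2 0, h2 n]
  have hEM : ∫ ω, M ω ^ 2 ∂Pr ≤ 2 * A ^ 2 * (v / (1 - γ) + n * (1 + W)) := by
    refine (hX.integral_sq_sum_sub_le hψm hψL hqL n).trans ?_
    refine le_trans (Finset.sum_le_sum fun k _ => ?_)
      ((Finset.mul_sum (Finset.range n) (fun k => γ ^ k * v + (1 + W)) (2 * A ^ 2)).symm.le.trans
        (mul_le_mul_of_nonneg_left (sum_range_pow_mul_add_le hγ0.le hγ1 hv n) (by positivity)))
    refine (hEψ (k + 1)).trans (mul_le_mul_of_nonneg_left ?_ (by positivity))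
    have h1 : γ ^ (k + 1) ≤ γ ^ k := pow_le_pow_of_le_one hγ0.le hγ1.le (Nat.le_succ k)
    linarith [mul_le_mul_of_nonneg_right h1 hv]
  have hEE : ∫ ω, E ω ^ 2 ∂Pr
      ≤ n * (4 * A ^ 2 * ε * (δ * v / (1 - γ) + n * (1 + δ * W))) := by
    have h1 : ∫ ω, E ω ^ 2 ∂Pr
        ≤ ∫ ω, (n : ℝ) * ∑ k ∈ Finset.range n, (q (X k ω) - p (X k ω)) ^ 2 ∂Pr :=
      integral_mono hEL.integrable_sq
        ((integrable_finsetSum _ fun k _ => (hdL k).integrable_sq).const_mul _) fun ω => by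
          have := sq_sum_le_card_mul_sum_sq (s := Finset.range n)
            (f := fun k => q (X k ω) - p (X k ω))
          simpa [hE] using this
    rw [integral_const_mul, integral_finsetSum _ fun k _ => (hdL k).integrable_sq] at h1
    refine h1.trans (mul_le_mul_of_nonneg_left ?_ hn0.le)
    refine le_trans (Finset.sum_le_sum fun k _ => (hEd k).trans_eq ?_)
      ((Finset.mul_sum (Finset.range n) (fun k => γ ^ k * (δ * v) + (1 + δ * W))
        (4 * A ^ 2 * ε)).symm.le.trans (mul_le_mul_of_nonneg_left
          (sum_range_pow_mul_add_le hγ0.le hγ1 (mul_nonneg hδ hv) n) (by positivity)))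
    ring
  have hTL : MemLp (fun ω => (1 / (n : ℝ)) * (B ω + M ω + E ω)) 2 Pr :=
    ((hBL.add hML).add hEL).const_mul _
  simp_rw [hdec]
  refine ⟨hTL.integrable_sq, ?_⟩
  have hBM : Integrable (fun ω => B ω ^ 2 + M ω ^ 2) Pr := hBL.integrable_sq.add hML.integrable_sq
  have hBME : Integrable (fun ω => B ω ^ 2 + M ω ^ 2 + E ω ^ 2) Pr := hBM.add hEL.integrable_sq
  have hfinal : ∫ ω, ((1 / (n : ℝ)) * (B ω + M ω + E ω)) ^ 2 ∂Pr
      ≤ 3 / (n : ℝ) ^ 2 * (∫ ω, B ω ^ 2 ∂Pr + ∫ ω, M ω ^ 2 ∂Pr + ∫ ω, E ω ^ 2 ∂Pr) := by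
    rw [← integral_add hBL.integrable_sq hML.integrable_sq, ← integral_add hBM hEL.integrable_sq,
      ← integral_const_mul]
    refine integral_mono hTL.integrable_sq (hBME.const_mul _) fun ω => ?_
    have h3 : (B ω + M ω + E ω) ^ 2 ≤ 3 * (B ω ^ 2 + M ω ^ 2 + E ω ^ 2) := by
      nlinarith [sq_nonneg (B ω - M ω), sq_nonneg (M ω - E ω), sq_nonneg (B ω - E ω)]
    have h4 := mul_le_mul_of_nonneg_left h3 (by positivity : 0 ≤ 1 / (n : ℝ) ^ 2)
    simp only
    calc ((1 / (n : ℝ)) * (B ω + M ω + E ω)) ^ 2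
        = 1 / (n : ℝ) ^ 2 * (B ω + M ω + E ω) ^ 2 := by ring
      _ ≤ _ := h4
      _ = _ := by ring
  refine hfinal.trans ?_
  have hs1 : √γ < 1 := by
    rw [Real.sqrt_lt' one_pos]
    linarith
  -- The `V x₀`-term: `1 / (1 - γ) ≤ 1 / (1 - √γ)` and `c₁ ≥ 2`.
  have hlast : 4 * A ^ 2 * ε * (δ * v / (1 - γ))
      ≤ 4 * A ^ 2 * (ε * δ * (2 + √K / (1 - √γ)) * v / (1 - √γ)) := by
    have hsγ : γ ≤ √γ := by
      rw [Real.le_sqrt' hγ0]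
      nlinarith
    have h1 : v / (1 - γ) ≤ v / (1 - √γ) :=
      div_le_div_of_nonneg_left hv (by linarith) (by linarith)
    have h2 : 0 ≤ √K / (1 - √γ) := div_nonneg (Real.sqrt_nonneg _) (by linarith)
    have h3 : 0 ≤ v / (1 - √γ) := div_nonneg hv (by linarith)
    have h4 : v / (1 - γ) ≤ (2 + √K / (1 - √γ)) * (v / (1 - √γ)) := by nlinarith
    have h5 := mul_le_mul_of_nonneg_left h4 (by positivity : 0 ≤ 4 * A ^ 2 * ε * δ)
    calc 4 * A ^ 2 * ε * (δ * v / (1 - γ)) = 4 * A ^ 2 * ε * δ * (v / (1 - γ)) := by ring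
      _ ≤ _ := h5
      _ = _ := by ring
  have hA1 : 0 ≤ A ^ 2 * (1 + W) := by positivity
  have hA2 : 0 ≤ 3 / (n : ℝ) := by positivity
  have hlast' := mul_le_mul_of_nonneg_left (add_le_add hlast
    (by linarith : 2 * (A ^ 2 * (1 + W)) ≤ 8 * (A ^ 2 * (1 + W)))) hA2
  have hsum := mul_le_mul_of_nonneg_left (add_le_add (add_le_add hEB hEM) hEE)
    (by positivity : 0 ≤ 3 / (n : ℝ) ^ 2)
  refine hsum.trans ?_
  have e1 : 3 / (n : ℝ) ^ 2 * (8 * A ^ 2 * (1 + v + W) + 2 * A ^ 2 * (v / (1 - γ) + n * (1 + W))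
        + n * (4 * A ^ 2 * ε * (δ * v / (1 - γ) + n * (1 + δ * W))))
      = 3 * (8 * A ^ 2 * (1 + v + W) + 2 * A ^ 2 * (v / (1 - γ))) / (n : ℝ) ^ 2
        + 12 * A ^ 2 * ε * (1 + δ * W)
        + 3 / n * (4 * A ^ 2 * ε * (δ * v / (1 - γ)) + 2 * (A ^ 2 * (1 + W))) := by
    field_simp
    ring
  have e2 : 3 * (2 * A) ^ 2 * ε * (1 + δ * W)
        + 3 * (2 * A) ^ 2 / n * (2 + 2 * K / (1 - γ)
          + ε * δ * (2 + √K / (1 - √γ)) * v / (1 - √γ))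
      = 12 * A ^ 2 * ε * (1 + δ * W)
        + 3 / n * (4 * A ^ 2 * (ε * δ * (2 + √K / (1 - √γ)) * v / (1 - √γ))
          + 8 * (A ^ 2 * (1 + W))) := by
    rw [mul_div_assoc 2 K, ← hW]
    ring
  rw [e1, e2]
  linarith

end MeanSquareError

/-- For `√V`-contractions the Poisson equation is solved with the bound
`(1 ∨ βh⁻¹) / (1 - αh) * (1 + √V)`. -/
lemma meanSquareErrorBound_of_contracts {S : Type u} [MeasurableSpace S] [Nonempty S]
    {P : Kernel S S} [IsMarkovKernel P] {V : S → ℝ} (hVm : Measurable V) (hV : ∀ x, 0 ≤ V x)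
    (hPV : ∀ x, Integrable V (P x)) {μ₀ : Measure S} [IsProbabilityMeasure μ₀]
    (hμ : Kernel.Invariant P μ₀) (hμV : Integrable V μ₀) {βh αh : ℝ}
    (hβ : 0 < βh) (hα0 : 0 < αh) (hα1 : αh < 1)
    (hC : Contracts P (fun x => √(V x)) βh αh) :
    MeanSquareErrorBound.{u, w} P V μ₀ (2 * max 1 (1 / βh) / (1 - αh)) := by
  have hg : 0 < 1 - αh := by linarith
  have hmax : 0 < max 1 (1 / βh) := lt_max_of_lt_left one_pos
  rw [mul_div_assoc]
  refine meanSquareErrorBound_of_poisson hVm hV hPV (by positivity) fun φ hφ hφV => ?_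
  have hL : 0 ≤ 1 / βh := by positivity
  have hw : ∀ x, 1 / βh * (1 + βh * √(V x)) = 1 / βh + √(V x) := fun x => by field_simp
  have hφL : ∀ x, |φ x| ≤ 1 / βh * (1 + βh * √(V x)) := fun x => by
    rw [hw]
    exact (hφV x).trans (le_add_of_nonneg_left hL)
  obtain ⟨ψ, hψm, hψb, hψ⟩ := exists_poisson_solution hVm.sqrt (fun x => Real.sqrt_nonneg (V x))
    (fun x => integrable_sqrt_of_integrable hVm hV (hPV x)) hβ.le hα0.le hα1 hC hL hφ
    hφL hμ (integrable_sqrt_of_integrable hVm hV hμV)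
  refine ⟨ψ, hψm, fun x => (hψb x).trans ?_, hψ⟩
  rw [div_mul_eq_mul_div _ (1 - αh), div_mul_eq_mul_div _ (1 - αh)]
  refine div_le_div_of_nonneg_right ?_ hg.le
  have h2 := le_max_right 1 (1 / βh)
  have h3 := mul_le_mul_of_nonneg_right (le_max_left 1 (1 / βh)) (Real.sqrt_nonneg (V x))
  rw [hw]
  linarith

end PerturbedChain

theorem mainTheorem1 {S : Type u} [TopologicalSpace S] [PolishSpace S] [MeasurableSpace S]
    [BorelSpace S] [Nonempty S]
    (P : Kernel S S) [IsMarkovKernel P]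
    (V : S → ℝ) (hVm : Measurable V) (hV : ∀ x, 0 ≤ V x)
    (γ K : ℝ) (hγ0 : 0 < γ) (hγ1 : γ < 1) (hK : 0 < K)
    (hdrift : PerturbedChain.LyapunovDrift P V γ K)
    (hsmall : PerturbedChain.SmallSublevelSets P V) :
    ∃ μ₀ : Measure S, IsProbabilityMeasure μ₀ ∧ Kernel.Invariant P μ₀ ∧
      (∀ ν : Measure S, IsProbabilityMeasure ν → Kernel.Invariant P ν → ν = μ₀) ∧
      Integrable V μ₀ ∧
      (∃ β α βh αh C : ℝ, 0 < β ∧ 0 < α ∧ α < 1 ∧ PerturbedChain.Contracts P V β α ∧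
        β < βh ∧ 0 < αh ∧ αh < 1 ∧ PerturbedChain.Contracts P (fun x => √(V x)) βh αh ∧
        0 < C ∧ C ≤ max 1 (∫ x, √(V x) ∂μ₀) / (1 - αh) ∧
        PerturbedChain.MeanSquareErrorBound.{u, w} P V μ₀ C) ∧
      (∀ βh αh : ℝ, 0 < βh → 0 < αh → αh < 1 →
        PerturbedChain.Contracts P (fun x => √(V x)) βh αh →
        PerturbedChain.MeanSquareErrorBound.{u, w} P V μ₀
          (2 * max 1 (1 / βh) / (1 - αh))) := by
  have hsm : Measurable fun x => √(V x) := hVm.sqrt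
  have hs0 : ∀ x, 0 ≤ √(V x) := fun x => Real.sqrt_nonneg _
  have hγs : √γ < 1 := by
    rw [Real.sqrt_lt' one_pos]
    linarith
  obtain ⟨βh, hβh, hβh'⟩ := PerturbedChain.exists_contracts hsm hs0 (Real.sqrt_pos.2 hγ0) hγs
    (Real.sqrt_pos.2 hK) (hdrift.sqrt hVm hV hγ0.le hK.le) hsmall.sqrt
  obtain ⟨αh, hαh0, hαh1, hCh⟩ := hβh' βh hβh le_rfl
  obtain ⟨β₀, hβ₀, hβ₀'⟩ := PerturbedChain.exists_contracts hVm hV hγ0 hγ1 hK hdrift hsmall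
  -- `β` may be any small parameter; half of `βh` makes it smaller than `βh`.
  have hβpos : 0 < min β₀ (βh / 2) := lt_min hβ₀ (by linarith)
  obtain ⟨α, hα0, hα1, hC⟩ := hβ₀' _ hβpos (min_le_left _ _)
  have hPV : ∀ x, Integrable V (P x) := fun x => (hdrift x).1
  obtain ⟨μ₀, hμ, hinv, hμV⟩ :=
    PerturbedChain.exists_invariant_of_contracts hVm hV hdrift hβpos hα1 hC
  refine ⟨μ₀, hμ, hinv, fun ν _ hν => PerturbedChain.eq_of_invariant_of_contracts hVm hV hPV
    hβpos.le hα0.le hα1 hC hinv hμV hν, hμV, ?_, fun βh αh h1 h2 h3 h4 =>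
    PerturbedChain.meanSquareErrorBound_of_contracts hVm hV hPV hinv hμV h1 h2 h3 h4⟩
  set C := 2 * max 1 (1 / βh) / (1 - αh) with hCdef
  have hmax : 1 ≤ max 1 (1 / βh) := le_max_left _ _
  have hC1 : 1 < C := by
    rw [hCdef, lt_div_iff₀ (by linarith)]
    linarith
  have hC0 : 0 < C := one_pos.trans hC1
  -- `1 - C⁻¹` is larger than `αh`, hence still a contraction factor, and it makes
  -- `1 / (1 - (1 - C⁻¹))` equal to `C`.
  have hle : αh ≤ 1 - C⁻¹ := by
    rw [hCdef, inv_div]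
    have h1 : (1 - αh) / (2 * max 1 (1 / βh)) ≤ 1 - αh :=
      div_le_self (by linarith) (by linarith)
    linarith
  refine ⟨_, α, βh, 1 - C⁻¹, C, hβpos, hα0, hα1, hC, (min_le_right _ _).trans_lt (by linarith),
    hαh0.trans_le hle, by linarith [inv_pos.2 hC0], hCh.mono hle, hC0, ?_,
    PerturbedChain.meanSquareErrorBound_of_contracts hVm hV hPV hinv hμV hβh hαh0 hαh1 hCh⟩
  rw [sub_sub_cancel, div_inv_eq_mul]
  exact le_mul_of_one_le_left hC0.le (le_max_left _ _)
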